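/- Let $\mathcal{P}_3$ denote the set of integer partitions in which parts divisible by $3$ may appear in two kinds, ordinary ($3,6,9,\dots$) and primed ($3',6',9',\dots$); parts not divisible by $3$ appear in one kind only. Write a partition in $\mathcal P_3$ as $\lambda_1\ge\lambda_2\ge\cdots$, and let the residue modulo $3$ of a part be $1$, $2$, $0$ (ordinary multiple of $3$) or $0'$ (primed multiple of $3$). For $n,k,m\ge 0$ let $A_3(n;k,m)$ be the number of partitions of $n$ in $\mathcal P_3$ with exactly $k$ parts congruent to $2$ and exactly $m$ parts congruent to $1$ modulo $3$, such that no part equals $1$ and for all consecutive parts $\lambda_i,\lambda_{i+1}$: (i) $\lambda_i-\lambda_{i+1}\ge 3$ if $\lambda_i$ has residue in $\{0,2\}$ and $\lambda_{i+1}$ has residue in $\{0',2\}$, or if $\lambda_i$ has residue in $\{0',1\}$ and $\lambda_{i+1}$ has residue in $\{0,1\}$; (ii) $\lambda_i-\lambda_{i+1}\ge 4$ if neither $\lambda_i$ nor $\lambda_{i+1}$ is divisible by $3$ and $\lambda_i-\lambda_{i+1}\not\equiv 2\pmod 3$. Then, as formal power series, with $(z;w)_\infty=\prod_{j\ge0}(1-zw^j)$,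 $$\sum_{n,k,m\ge 0}A_3(n;k,m)\,q^n a^k d^m=\frac{(-aq^2;q^6)_\infty(-dq^4;q^6)_\infty(-q^3;q^3)_\infty}{(q^3;q^3)_\infty}.$$ In other words, let $B_3(n;k,m)$ be the number of partitions of $n$ in $\mathcal P_3$ in which every part not divisible by $3$ is congruent to $2$ or $4$ modulo $6$, parts not divisible by $3$ are distinct, and no primed multiple of $3$ is repeated (ordinary multiples of $3$ may repeat), with exactly $k$ parts congruent to $2$ and exactly $m$ parts congruent to $4$ modulo $6$. Then $$A_3(n;k,m)=B_3(n;k,m)\qquad\text{for all } n,k,m\ge 0.$$ -/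

import Mathlib

/-- A part of a partition in which multiples of 3 come in two kinds, ordinary and primed: a positive
integer together with a mark `primed`, which only a multiple of 3 may carry. -/
@[ext]
structure P3Part where
  size : ℕ
  primed : Bool
  pos : 0 < size
  dvd_of_primed : primed = true → 3 ∣ size

/-- Residues modulo 3, the residue 0 being `zero` for ordinary and `zeroPrimed` for primed parts. -/
inductive P3Residue where
  | zero
  | zeroPrimed
  | one
  | two

/-- The residue modulo 3 of a part, remembering its kind. -/
def P3Part.residue (x : P3Part) : P3Residue :=
  if x.primed = true then P3Residue.zeroPrimed
  else if x.size % 3 = 0 then P3Residue.zero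
  else if x.size % 3 = 1 then P3Residue.one
  else P3Residue.two

/-- Partitions with ordinary and primed multiples of 3, as sequences `λ₁ ≥ λ₂ ≥ ⋯` of parts.
Among parts of equal size the primed ones are listed first (the order is `3 < 3' < 6 < 6' < ⋯` on
multiples of 3), so that every partition is represented by exactly one sequence. -/
@[ext]
structure P3Partition where
  parts : List P3Part
  sorted : parts.Pairwise fun x y =>
    y.size < x.size ∨ (y.size = x.size ∧ (y.primed = true → x.primed = true))

namespace P3Partition

/-- The integer that is partitioned. -/
def weight (p : P3Partition) : ℕ := (p.parts.map P3Part.size).sum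

/-- The number of parts whose size is congruent to `r` modulo `N`. -/
def numParts (p : P3Partition) (r N : ℕ) : ℕ :=
  p.parts.countP fun x => decide (x.size ≡ r [MOD N])

/-- The condition on a part `x` and the next part `y` under which their difference is at least 3. -/
def Gap3 (x y : P3Part) : Prop :=
  (x.residue ∈ ({P3Residue.zero, P3Residue.two} : Set P3Residue) ∧
    y.residue ∈ ({P3Residue.zeroPrimed, P3Residue.two} : Set P3Residue)) ∨
  (x.residue ∈ ({P3Residue.zeroPrimed, P3Residue.one} : Set P3Residue) ∧
    y.residue ∈ ({P3Residue.zero, P3Residue.one} : Set P3Residue))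

/-- The condition on a part `x` and the next part `y` under which their difference is at least 4. -/
def Gap4 (x y : P3Part) : Prop :=
  ¬ 3 ∣ x.size ∧ ¬ 3 ∣ y.size ∧ ¬ ((x.size : ℤ) - (y.size : ℤ) ≡ 2 [ZMOD 3])

/-- No part is equal to 1, and consecutive parts satisfy the difference conditions. -/
def IsA3 (p : P3Partition) : Prop :=
  (∀ x ∈ p.parts, x.size ≠ 1) ∧
  p.parts.IsChain fun x y =>
    (Gap3 x y → (3 : ℤ) ≤ (x.size : ℤ) - (y.size : ℤ)) ∧
    (Gap4 x y → (4 : ℤ) ≤ (x.size : ℤ) - (y.size : ℤ))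

/-- Parts not divisible by 3 are congruent to 2 or 4 modulo 6, and neither parts not divisible by 3
nor primed multiples of 3 repeat (ordinary multiples of 3 may). -/
def IsB3 (p : P3Partition) : Prop :=
  (∀ x ∈ p.parts, ¬ 3 ∣ x.size → x.size ≡ 2 [MOD 6] ∨ x.size ≡ 4 [MOD 6]) ∧
  p.parts.Pairwise fun x y => x = y → 3 ∣ x.size ∧ x.primed = false

/-- An integer has finitely many partitions, so the cardinalities below are genuine. -/
theorem finite_weight_eq (n : ℕ) : {p : P3Partition | p.weight = n}.Finite := by
  let f : P3Partition → List (ℕ × Bool) := fun p => p.parts.map fun x => (x.size, x.primed)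
  have hf : Function.Injective f := by
    intro p r h
    apply P3Partition.ext
    refine List.map_injective_iff.mpr ?_ h
    intro x y hxy
    simp only [Prod.mk.injEq] at hxy
    exact P3Part.ext hxy.1 hxy.2
  let g : List (Fin (n + 1) × Bool) → List (ℕ × Bool) := fun l => l.map fun x => (x.1.val, x.2)
  refine Set.Finite.of_finite_image (f := f) ?_ hf.injOn
  refine ((List.finite_length_le (Fin (n + 1) × Bool) n).image g).subset ?_
  rintro _ ⟨p, hp, rfl⟩
  have hp' : (p.parts.map P3Part.size).sum = n := hp
  have hle : ∀ x ∈ p.parts, x.size < n + 1 := by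
    intro x hx
    have := List.le_sum_of_mem (List.mem_map_of_mem (f := P3Part.size) hx)
    omega
  refine ⟨p.parts.map fun x => (Fin.ofNat (n + 1) x.size, x.primed), ?_, ?_⟩
  · have h := List.length_le_sum_of_one_le (p.parts.map P3Part.size) (by
      intro i hi
      obtain ⟨x, _, rfl⟩ := List.mem_map.mp hi
      exact x.pos)
    simp only [List.length_map] at h
    simp only [Set.mem_ofPred_eq, List.length_map]
    omega
  · simp only [g, f, List.map_map]
    refine List.map_congr_left ?_
    intro x hx
    simp [Fin.ofNat, Nat.mod_eq_of_lt (hle x hx)]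

end P3Partition

/-- The number of partitions of `n` satisfying the difference conditions, with `k` parts congruent
to 2 and `m` parts congruent to 1 modulo 3. -/
noncomputable def A3 (n k m : ℕ) : ℕ :=
  {p : P3Partition | p.weight = n ∧ p.IsA3 ∧ p.numParts 2 3 = k ∧ p.numParts 1 3 = m}.ncard

/-- The number of partitions of `n` satisfying the congruence conditions, with `k` parts congruent
to 2 and `m` parts congruent to 4 modulo 6. -/
noncomputable def B3 (n k m : ℕ) : ℕ :=
  {p : P3Partition | p.weight = n ∧ p.IsB3 ∧ p.numParts 2 6 = k ∧ p.numParts 4 6 = m}.ncard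

/-- Formal power series over `ℚ` in three variables `q`, `a`, `d`. -/
abbrev QAD : Type := MvPowerSeries (Fin 3) ℚ

namespace QAD

noncomputable def q : QAD := MvPowerSeries.X 0
noncomputable def a : QAD := MvPowerSeries.X 1
noncomputable def d : QAD := MvPowerSeries.X 2

section
open scoped MvPowerSeries.WithPiTopology

/-- The infinite product `(z; w)_∞ = ∏_{j ≥ 0} (1 - z w ^ j)`, a limit of formal power series
(coefficientwise). -/
noncomputable def qPoch (z w : QAD) : QAD := ∏' j : ℕ, (1 - z * w ^ j)

/-- The product `(z; w)_∞` converges as soon as `w` has no constant term. -/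
theorem multipliable_qPoch (z w : QAD) (hw : MvPowerSeries.constantCoeff w = 0) :
    Multipliable fun j : ℕ => 1 - z * w ^ j := by
  have h : Multipliable fun j : ℕ => 1 + (-(z * w ^ j)) := by
    apply MvPowerSeries.WithPiTopology.multipliable_one_add_of_tendsto_order_atTop_nhds_top
    refine ENat.tendsto_nhds_top_iff_natCast_lt.mpr fun N => ?_
    filter_upwards [Filter.eventually_gt_atTop N] with j hj
    rw [MvPowerSeries.order_neg]
    calc (N : ℕ∞) < (j : ℕ∞) := by exact_mod_cast hj
      _ ≤ (w ^ j).order := MvPowerSeries.le_order_pow_of_constantCoeff_eq_zero j hw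
      _ ≤ z.order + (w ^ j).order := le_add_self
      _ ≤ (z * w ^ j).order := MvPowerSeries.le_order_mul
  simpa only [sub_eq_add_neg] using h

end

end QAD

/-- The generating function `∑ A₃(n; k, m) q ^ n a ^ k d ^ m`; the exponent vector `e` lists the
exponents of `q`, `a` and `d`. -/
noncomputable def A3GenFun : QAD := fun e => (A3 (e 0) (e 1) (e 2) : ℚ)

/-! List the parts other than 1 as 2, 3, 3', 4, 5, 6, 6', 7, ..., four to a level, and put Q = q³, x
= aq², y = dq⁴. Admissibility of neighbours depends only on their positions, so deleting the largest
part gives linear equations between the series G_k of partitions on the first k levels and the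
series with prescribed largest part (`levelSystem`). With h_0 = 1 and h_{k+1} = G_k / (1 - Q^{k+1}),
eliminating the other unknowns leaves one third-order recurrence for h (`LevelSystem.recurrence`).

Its solution is h_m = Σ_n A_n / (Q;Q)_{m-2n} with A_n = Q^{n(n-1)} c_n / (Q;Q²)_n, where c_n is the
coefficient of t^n in (Σ u_i t^i)(Σ v_j t^j), u_i = ∏_{k<i} (x + Q^{2k+1}) / (1 - Q^{2k+2}) and v_j
= y^j (-x;Q²)_j / (Q²;Q²)_j. The two factors satisfy first-order Q²-difference equations, which pass
to c_n, then A_n, then h_m (`convTerm_recurrence`, `boundedSeries_recurrence`).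

As m grows, (Q;Q)_∞ h_m tends to Σ A_n. In this double sum over i and j, the inner sum over i equals
(-x;Q²)_∞ / ((Q;Q²)_∞ (-x;Q²)_j) by telescoping in j; the factor (-x;Q²)_j cancels against v_j, and
Euler's expansion of (-y;Q²)_∞ remains (`exists_hasSum_convTerm`). Euler's (Q;Q²)_∞ (-Q;Q)_∞ = 1
then gives the product. On the B side the parts are chosen independently, so the same product
appears directly (`belowB_eq_prod`). -/

/-! ### Recurrences from Q-difference equations -/

open PowerSeries in
/-- The functional equation of a series whose consecutive coefficients have a ratio of the form
`(α + β p ^ i) / (1 - p ^ (i + 1))`. -/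
theorem rescale_mk_of_ratio {R : Type*} [CommRing R] {p α β : R} {u : ℕ → R}
    (hu : ∀ i, u (i + 1) * (1 - p ^ (i + 1)) = (α + β * p ^ i) * u i) :
    (1 - C α * X) * mk u = (1 + C β * X) * rescale p (mk u) := by
  ext n
  rw [sub_mul, add_mul, one_mul, one_mul, mul_assoc, mul_assoc, map_sub, map_add, coeff_C_mul,
    coeff_C_mul]
  cases n with
  | zero => simp
  | succ n =>
    rw [coeff_succ_X_mul, coeff_succ_X_mul, coeff_rescale, coeff_rescale, coeff_mk, coeff_mk]
    linear_combination hu n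

open PowerSeries in
theorem rescale_expand_two {R : Type*} [CommRing R] (r : R) (φ : PowerSeries R) :
    rescale r (expand 2 two_ne_zero φ) = expand 2 two_ne_zero (rescale (r ^ 2) φ) := by
  ext n
  rw [coeff_rescale, coeff_expand, coeff_expand]
  split_ifs with h
  · obtain ⟨m, rfl⟩ := h
    rw [Nat.mul_div_cancel_left _ two_pos, coeff_rescale, pow_mul]
  · simp

-- Multiplying the two first-order equations gives (1 - xX)(1 - yX) W(X) = (1 + QX)(1 + xyX) W(Q²X)
-- for the product W; compare coefficients. The parameters are matched so that the last coefficient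
-- has the factor 1 - Q·Q^{2n}.
open PowerSeries in
theorem coeff_mul_recurrence {R : Type*} [CommRing R] {Q x y : R} {u v : ℕ → R}
    (hu : ∀ i, u (i + 1) * (1 - (Q ^ 2) ^ (i + 1)) = (x + Q * (Q ^ 2) ^ i) * u i)
    (hv : ∀ i, v (i + 1) * (1 - (Q ^ 2) ^ (i + 1)) = (y + x * y * (Q ^ 2) ^ i) * v i) :
    (∀ n, (1 - (Q ^ 2) ^ (n + 2)) * coeff (n + 2) (mk u * mk v) =
      (x + y + (Q + x * y) * (Q ^ 2) ^ (n + 1)) * coeff (n + 1) (mk u * mk v) -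
        x * y * (1 - Q * (Q ^ 2) ^ n) * coeff n (mk u * mk v)) ∧
    (1 - Q ^ 2) * coeff 1 (mk u * mk v) = (x + y + (Q + x * y)) * coeff 0 (mk u * mk v) := by
  have h : mk u * mk v - rescale (Q ^ 2) (mk u * mk v) =
      C (x + y) * (X * (mk u * mk v)) + C (Q + x * y) * (X * rescale (Q ^ 2) (mk u * mk v)) -
        C (x * y) * (X * (X * (mk u * mk v))) +
        C (Q * (x * y)) * (X * (X * rescale (Q ^ 2) (mk u * mk v))) := by
    have h1 := rescale_mk_of_ratio hu
    have h2 := rescale_mk_of_ratio hv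
    simp only [map_add, map_mul] at h1 h2 ⊢
    linear_combination ((1 - C y * X) * mk v) * h1 + ((1 + C Q * X) * rescale (Q ^ 2) (mk u)) * h2
  constructor
  · intro n
    have := congrArg (coeff (n + 2)) h
    simp only [map_sub, LinearMap.map_add, coeff_C_mul, coeff_succ_X_mul, coeff_rescale] at this
    linear_combination this
  · have := congrArg (coeff (0 + 1)) h
    simp only [map_sub, LinearMap.map_add, coeff_C_mul, coeff_succ_X_mul, coeff_rescale,
      coeff_zero_X_mul, zero_add] at this
    linear_combination this

open PowerSeries in
/-- `Q ^ (n ^ 2 - n)` times the `n`-th coefficient of `(∑ u i t ^ i) (∑ v j t ^ j)`, times `f n`. -/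
noncomputable def convTerm {R : Type*} [CommRing R] (Q : R) (u v f : ℕ → R) (n : ℕ) : R :=
  Q ^ (n * (n - 1)) * coeff n (mk u * mk v) * f n

/-- The factor 1 - Q·Q^{2n} on the oldest term is absorbed by f, which behaves like 1/(Q;Q²)_n; the
power Q^{n(n-1)} accounts for the remaining shifts. -/
theorem convTerm_recurrence {R : Type*} [CommRing R] {Q x y : R} {u v f : ℕ → R}
    (hu : ∀ i, u (i + 1) * (1 - (Q ^ 2) ^ (i + 1)) = (x + Q * (Q ^ 2) ^ i) * u i)
    (hv : ∀ i, v (i + 1) * (1 - (Q ^ 2) ^ (i + 1)) = (y + x * y * (Q ^ 2) ^ i) * v i)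
    (hf : ∀ i, f (i + 1) * (1 - Q * (Q ^ 2) ^ i) = f i) :
    (∀ n, (1 - (Q ^ 2) ^ (n + 2)) * (1 - Q * (Q ^ 2) ^ (n + 1)) * convTerm Q u v f (n + 2) =
      (x + y + (Q + x * y) * (Q ^ 2) ^ (n + 1)) * (Q ^ 2) ^ (n + 1) * convTerm Q u v f (n + 1) -
        x * y * (Q ^ 2) ^ (2 * n + 1) * convTerm Q u v f n) ∧
    (1 - Q ^ 2) * (1 - Q) * convTerm Q u v f 1 =
      (x + y + (Q + x * y)) * convTerm Q u v f 0 := by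
  obtain ⟨h, h1⟩ := coeff_mul_recurrence hu hv
  constructor
  · intro n
    have e1 : (n + 2) * (n + 2 - 1) = n * (n - 1) + 4 * n + 2 := by
      cases n with
      | zero => rfl
      | succ n => simp only [Nat.add_sub_cancel, show n + 1 + 2 - 1 = n + 2 by omega]; ring
    have e2 : (n + 1) * (n + 1 - 1) = n * (n - 1) + 2 * n := by
      cases n with
      | zero => rfl
      | succ n => simp only [Nat.add_sub_cancel]; ring
    simp only [convTerm]
    rw [e1, e2, add_assoc, pow_add _ _ (4 * n + 2), pow_add _ _ (2 * n)]
    generalize Q ^ (n * (n - 1)) = T at *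
    have hn := h n
    generalize PowerSeries.coeff (n + 2) (PowerSeries.mk u * PowerSeries.mk v) = c2 at *
    generalize PowerSeries.coeff (n + 1) (PowerSeries.mk u * PowerSeries.mk v) = c1 at *
    generalize PowerSeries.coeff n (PowerSeries.mk u * PowerSeries.mk v) = c0 at *
    have f1 := hf (n + 1)
    have f0 := hf n
    linear_combination T * Q ^ (4 * n + 2) * f (n + 1) * hn +
      T * Q ^ (4 * n + 2) * (1 - (Q ^ 2) ^ (n + 2)) * c2 * f1 -
      x * y * T * Q ^ (4 * n + 2) * c0 * f0
  · have f0 := hf 0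
    simp only [convTerm]
    simp only [zero_add, pow_zero, mul_one] at f0
    simp only [Nat.sub_self, mul_zero, zero_mul, pow_zero, one_mul]
    linear_combination (1 - Q) * f 1 * h1 +
      (x + y + (Q + x * y)) * PowerSeries.coeff 0 (PowerSeries.mk u * PowerSeries.mk v) * f0

open PowerSeries in
/-- `∑ A n * e (m - 2 n)`, as a coefficient of a product of power series. -/
noncomputable def boundedSeries {R : Type*} [CommRing R] (e A : ℕ → R) (m : ℕ) : R :=
  coeff m (mk e * expand 2 two_ne_zero (mk A))

open PowerSeries in
theorem boundedSeries_functional {R : Type*} [CommRing R] {Q x y : R} {e A : ℕ → R}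
    (he : ∀ i, e (i + 1) * (1 - Q ^ (i + 1)) = e i)
    (hA : ∀ n, (1 - (Q ^ 2) ^ (n + 2)) * (1 - Q * (Q ^ 2) ^ (n + 1)) * A (n + 2) =
      (x + y + (Q + x * y) * (Q ^ 2) ^ (n + 1)) * (Q ^ 2) ^ (n + 1) * A (n + 1) -
        x * y * (Q ^ 2) ^ (2 * n + 1) * A n)
    (hA1 : (1 - Q ^ 2) * (1 - Q) * A 1 = (x + y + (Q + x * y)) * A 0) (F : PowerSeries R)
    (hF : F = mk e * expand 2 two_ne_zero (mk A)) :
    C Q * F - C (1 + Q) * rescale Q F + rescale (Q ^ 2) F =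
      C Q * (X * F) - C Q * (X * rescale (Q ^ 2) F) + C ((x + y) * Q) * (X * (X * rescale Q F)) +
        C (x * y * Q) * (X * (X * rescale (Q ^ 2) F)) +
        C (x * y * Q ^ 2) * (X * (X * (X * rescale (Q ^ 2) F))) := by
  have hE : (1 - X) * mk e = rescale Q (mk e) := by
    have := rescale_mk_of_ratio (p := Q) (α := 1) (β := 0) (u := e) fun i => by
      rw [he i]; ring
    simpa using this
  have hE2 : (1 - C Q * X) * rescale Q (mk e) = rescale (Q ^ 2) (mk e) := by
    have := congrArg (rescale Q) hE
    rw [map_mul, map_sub, map_one, rescale_X, rescale_rescale, ← pow_two] at this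
    exact this
  -- The extra factor Q turns (1 - p^n)(1 - Q p^{n-1}), p = Q², into (1 - p^n)(Q - p^n), so that
  -- only rescalings by p and p² occur.
  have hg : C Q * mk A = C (1 + Q) * rescale (Q ^ 2) (mk A) +
      C ((x + y) * Q) * (X * rescale (Q ^ 2) (mk A)) - rescale ((Q ^ 2) ^ 2) (mk A) +
      C (Q ^ 2 + x * y * Q) * (X * rescale ((Q ^ 2) ^ 2) (mk A)) -
      C (x * y * Q ^ 3) * (X * (X * rescale ((Q ^ 2) ^ 2) (mk A))) := by
    ext n
    simp only [map_sub, LinearMap.map_add, coeff_C_mul]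
    match n with
    | 0 => simp; ring
    | 1 =>
      rw [show (1 : ℕ) = 0 + 1 from rfl]
      simp only [coeff_succ_X_mul, coeff_rescale, coeff_zero_X_mul, coeff_mk, zero_add]
      linear_combination Q * hA1
    | n + 2 =>
      simp only [coeff_succ_X_mul, coeff_rescale, coeff_mk]
      linear_combination Q * hA n
  have hg2 := congrArg (expand 2 two_ne_zero) hg
  simp only [map_sub, map_add, map_mul, map_pow, map_one, expand_C, expand_X,
    ← rescale_expand_two] at hg2
  subst hF
  simp only [map_mul, ← hE2, ← hE, map_add, map_pow, map_one] at hg2 ⊢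
  -- After X is replaced by X², the coefficient of A(Q⁴X²) is divisible by 1 - QX, the factor by
  -- which E(Q²X) and E(QX) differ, E being the series of e. Hence the equation closes up in F,
  -- F(QX), F(Q²X).
  linear_combination (1 - X) * mk e * hg2

open PowerSeries in
theorem boundedSeries_recurrence {R : Type*} [CommRing R] [IsDomain R] {Q x y : R} {e A : ℕ → R}
    (hQ : Q ≠ 0) (he : ∀ i, e (i + 1) * (1 - Q ^ (i + 1)) = e i)
    (hA : ∀ n, (1 - (Q ^ 2) ^ (n + 2)) * (1 - Q * (Q ^ 2) ^ (n + 1)) * A (n + 2) =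
      (x + y + (Q + x * y) * (Q ^ 2) ^ (n + 1)) * (Q ^ 2) ^ (n + 1) * A (n + 1) -
        x * y * (Q ^ 2) ^ (2 * n + 1) * A n)
    (hA1 : (1 - Q ^ 2) * (1 - Q) * A 1 = (x + y + (Q + x * y)) * A 0) :
    (∀ m, (1 - Q ^ (m + 2)) * (1 - Q ^ (m + 3)) * boundedSeries e A (m + 3) =
      (1 - Q ^ (2 * m + 4)) * boundedSeries e A (m + 2) +
        ((x + y) * Q ^ (m + 1) + x * y * Q ^ (2 * m + 2)) * boundedSeries e A (m + 1) +
        x * y * Q ^ (2 * m + 1) * boundedSeries e A m) ∧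
    (1 - Q) * (1 - Q ^ 2) * boundedSeries e A 2 =
      (1 - Q ^ 2) * boundedSeries e A 1 + (x + y + x * y) * boundedSeries e A 0 := by
  have h := boundedSeries_functional he hA hA1 _ rfl
  simp only [boundedSeries]
  generalize mk e * expand 2 two_ne_zero (mk A) = F at *
  constructor
  · intro m
    have := congrArg (coeff (m + 3)) h
    simp only [map_sub, LinearMap.map_add, coeff_C_mul, coeff_succ_X_mul, coeff_rescale] at this
    apply mul_left_cancel₀ hQ
    linear_combination this
  · have := congrArg (coeff (0 + 2)) h
    simp only [map_sub, LinearMap.map_add, coeff_C_mul, coeff_succ_X_mul, coeff_rescale,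
      coeff_zero_X_mul, zero_add] at this
    apply mul_left_cancel₀ hQ
    linear_combination this

theorem boundedSeries_zero {R : Type*} [CommRing R] (e A : ℕ → R) :
    boundedSeries e A 0 = e 0 * A 0 := by
  simp [boundedSeries, PowerSeries.coeff_mul, PowerSeries.coeff_expand]

theorem boundedSeries_one {R : Type*} [CommRing R] (e A : ℕ → R) :
    boundedSeries e A 1 = e 1 * A 0 := by
  simp [boundedSeries, PowerSeries.coeff_mul, PowerSeries.coeff_expand,
    Finset.Nat.antidiagonal_succ]

/-! ### Elimination in the level equations -/

/-- A family of generating functions `ga k`, `gb k`, `gc k`, `gd k` (by the first part, which lies on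
level `k + 1`), with sums `G k` over the levels up to `k`, that satisfies the equations obtained by
removing the first part. -/
structure LevelSystem {R : Type*} [CommRing R] (Q x y : R) (ga gb gc gd G : ℕ → R) : Prop where
  G_zero : G 0 = 1
  G_succ : ∀ k, G (k + 1) = G k + ga k + gb k + gc k + gd k
  a_zero : ga 0 = x
  a_succ : ∀ k, ga (k + 1) = x * Q ^ (k + 1) * (G k + gb k)
  b_eq : ∀ k, gb k = Q ^ (k + 1) * (G k + gb k)
  c_zero : gc 0 = Q * (G 0 + ga 0 + gc 0)
  c_succ : ∀ k, gc (k + 1) = Q ^ (k + 2) * (G (k + 1) - gd k + ga (k + 1) + gc (k + 1))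
  d_zero : gd 0 = y * (G 0 + ga 0 + gc 0)
  d_succ : ∀ k, gd (k + 1) = y * Q ^ (k + 1) * (G (k + 1) - gd k + ga (k + 1) + gc (k + 1))

namespace LevelSystem

variable {R : Type*} [CommRing R] [IsDomain R] {Q x y : R} {ga gb gc gd G h : ℕ → R}

theorem recurrence (S : LevelSystem Q x y ga gb gc gd G) (hQ : ∀ k, 1 - Q ^ (k + 1) ≠ 0)
    (h0 : h 0 = 1) (hG : ∀ k, h (k + 1) * (1 - Q ^ (k + 1)) = G k) :
    (∀ m, (1 - Q ^ (m + 2)) * (1 - Q ^ (m + 3)) * h (m + 3) =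
      (1 - Q ^ (2 * m + 4)) * h (m + 2) +
        ((x + y) * Q ^ (m + 1) + x * y * Q ^ (2 * m + 2)) * h (m + 1) +
        x * y * Q ^ (2 * m + 1) * h m) ∧
    (1 - Q) * (1 - Q ^ 2) * h 2 = (1 - Q ^ 2) * h 1 + (x + y + x * y) * h 0 := by
  have hb : ∀ k, G k + gb k = h (k + 1) := fun k => by
    apply mul_right_cancel₀ (hQ k)
    linear_combination S.b_eq k - hG k
  have ha : ∀ k, ga k = x * Q ^ k * h k := fun k => by
    cases k with
    | zero => rw [S.a_zero, h0]; ring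
    | succ k => rw [S.a_succ, hb]
  obtain ⟨w, hw0, hw⟩ : ∃ w : ℕ → R, w 0 = G 0 + ga 0 + gc 0 ∧
      ∀ k, w (k + 1) = G (k + 1) - gd k + ga (k + 1) + gc (k + 1) :=
    ⟨fun k => Nat.casesOn k (G 0 + ga 0 + gc 0)
      fun k => G (k + 1) - gd k + ga (k + 1) + gc (k + 1), rfl, fun _ => rfl⟩
  have hc : ∀ k, gc k = Q ^ (k + 1) * w k := fun k => by
    cases k with
    | zero => rw [S.c_zero, hw0]; ring
    | succ k => rw [S.c_succ, hw]
  have hd : ∀ k, gd k = y * Q ^ k * w k := fun k => by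
    cases k with
    | zero => rw [S.d_zero, hw0]; ring
    | succ k => rw [S.d_succ, hw]
  -- This expresses w through h alone; substituting it into the defining equation of w gives the
  -- recurrence. As Q + y is only multiplied by, it need not be invertible.
  have hsum : ∀ k, Q ^ k * (Q + y) * w k =
      (1 - Q ^ (k + 2)) * h (k + 2) - h (k + 1) - x * Q ^ k * h k := fun k => by
    have h1 := S.G_succ k
    rw [ha, hc, hd] at h1
    linear_combination -h1 - hG (k + 1) - hb k
  constructor
  · intro m
    have hm := hw m
    rw [hc, ha, hd] at hm
    linear_combination Q ^ (m + 1) * (Q + y) * hm - (1 - Q ^ (m + 2)) * hsum (m + 1) -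
      y * Q ^ (m + 1) * hsum m - Q ^ (m + 1) * (Q + y) * hG (m + 1)
  · have h2 := hsum 0
    rw [hc, ha, S.G_zero] at hw0
    have := hG 0
    rw [S.G_zero] at this
    linear_combination (Q + y) * hw0 - (1 - Q) * h2 - Q * this - y * h0

theorem eq_of_recurrence (hQ : ∀ k, 1 - Q ^ (k + 1) ≠ 0) {F : ℕ → R}
    (hF : ∀ m, (1 - Q ^ (m + 2)) * (1 - Q ^ (m + 3)) * F (m + 3) =
      (1 - Q ^ (2 * m + 4)) * F (m + 2) +
        ((x + y) * Q ^ (m + 1) + x * y * Q ^ (2 * m + 2)) * F (m + 1) +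
        x * y * Q ^ (2 * m + 1) * F m)
    (hF2 : (1 - Q) * (1 - Q ^ 2) * F 2 = (1 - Q ^ 2) * F 1 + (x + y + x * y) * F 0)
    (hh : ∀ m, (1 - Q ^ (m + 2)) * (1 - Q ^ (m + 3)) * h (m + 3) =
      (1 - Q ^ (2 * m + 4)) * h (m + 2) +
        ((x + y) * Q ^ (m + 1) + x * y * Q ^ (2 * m + 2)) * h (m + 1) +
        x * y * Q ^ (2 * m + 1) * h m)
    (hh2 : (1 - Q) * (1 - Q ^ 2) * h 2 = (1 - Q ^ 2) * h 1 + (x + y + x * y) * h 0)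
    (e0 : h 0 = F 0) (e1 : h 1 = F 1) : ∀ m, h m = F m := by
  have e2 : h 2 = F 2 := by
    apply mul_left_cancel₀ (mul_ne_zero (hQ 0) (hQ 1))
    rw [zero_add, pow_one, hF2, hh2, e0, e1]
  have key : ∀ m, h m = F m ∧ h (m + 1) = F (m + 1) ∧ h (m + 2) = F (m + 2) := by
    intro m
    induction m with
    | zero => exact ⟨e0, e1, e2⟩
    | succ m ih =>
      obtain ⟨i0, i1, i2⟩ := ih
      refine ⟨i1, i2, ?_⟩
      apply mul_left_cancel₀ (mul_ne_zero (hQ (m + 1)) (hQ (m + 2)))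
      rw [hF m, hh m, i0, i1, i2]
  exact fun m => (key m).1

end LevelSystem

/-! ### Words with restricted neighbours -/

namespace WordCount

/-- The generating function of a set of words over `ℕ`, where the letter `t` has weight `wt t`. -/
noncomputable def genFun (wt : ℕ → Fin 3 →₀ ℕ) (S : Set (List ℕ)) : QAD :=
  fun e => ({l | l ∈ S ∧ (l.map wt).sum = e}.ncard : ℚ)

theorem coeff_genFun (wt : ℕ → Fin 3 →₀ ℕ) (S : Set (List ℕ)) (e : Fin 3 →₀ ℕ) :
    MvPowerSeries.coeff e (genFun wt S) = ({l | l ∈ S ∧ (l.map wt).sum = e}.ncard : ℚ) := rfl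

variable {wt : ℕ → Fin 3 →₀ ℕ}

theorem sum_map_apply (l : List ℕ) (i : Fin 3) :
    (l.map wt).sum i = (l.map fun t => wt t i).sum := by
  induction l with
  | nil => rfl
  | cons t l ih => simp [ih]

/-- The bound on `wt` leaves only finitely many letters available for a given exponent of q;
finiteness and the stabilisation of `below` rest on this. -/
theorem lt_of_mem_of_sum_eq (hwt : ∀ t, t < 4 * wt t 0) {l : List ℕ} {e : Fin 3 →₀ ℕ}
    (hl : (l.map wt).sum = e) {t : ℕ} (ht : t ∈ l) : t < 4 * e 0 := by
  have h := List.le_sum_of_mem (List.mem_map_of_mem (f := fun t => wt t 0) ht)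
  rw [← sum_map_apply, hl] at h
  have := hwt t
  omega

theorem finite_sum_eq (hwt : ∀ t, t < 4 * wt t 0) (e : Fin 3 →₀ ℕ) :
    {l : List ℕ | (l.map wt).sum = e}.Finite := by
  refine ((List.finite_length_le (Fin (4 * e 0)) (e 0)).image (List.map Fin.val)).subset ?_
  intro l hl
  have hl' : (l.map wt).sum = e := hl
  refine ⟨l.pmap Fin.mk fun t ht => lt_of_mem_of_sum_eq hwt hl' ht, ?_, ?_⟩
  · have h := List.length_le_sum_of_one_le (l.map fun t => wt t 0) (by
      intro i hi
      obtain ⟨t, _, rfl⟩ := List.mem_map.mp hi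
      have := hwt t
      omega)
    rw [← sum_map_apply, hl', List.length_map] at h
    simpa using h
  · simp [List.map_pmap]

theorem genFun_union (hwt : ∀ t, t < 4 * wt t 0) {S T : Set (List ℕ)} (h : Disjoint S T) :
    genFun wt (S ∪ T) = genFun wt S + genFun wt T := by
  ext e
  rw [map_add, coeff_genFun, coeff_genFun, coeff_genFun, ← Nat.cast_add]
  congr 1
  rw [← Set.ncard_union_eq (Set.disjoint_left.mpr fun l hS hT =>
      Set.disjoint_left.mp h hS.1 hT.1) ((finite_sum_eq hwt e).subset fun l hl => hl.2)
    ((finite_sum_eq hwt e).subset fun l hl => hl.2)]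
  congr 1
  ext l
  simp only [Set.mem_ofPred_eq, Set.mem_union]
  tauto

theorem genFun_empty : genFun wt ∅ = 0 := by
  ext e
  rw [coeff_genFun]
  simp

theorem genFun_singleton_nil : genFun wt {[]} = 1 := by
  classical
  ext e
  rw [coeff_genFun, MvPowerSeries.coeff_one]
  split_ifs with h
  · subst h
    rw [show {l : List ℕ | l ∈ ({[]} : Set (List ℕ)) ∧ (l.map wt).sum = 0} = {[]} by
      ext l
      simp only [Set.mem_ofPred_eq, Set.mem_singleton_iff, and_iff_left_iff_imp]
      rintro rfl
      rfl]
    simp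
  · rw [show {l : List ℕ | l ∈ ({[]} : Set (List ℕ)) ∧ (l.map wt).sum = e} = ∅ by
      ext l
      simp only [Set.mem_ofPred_eq, Set.mem_singleton_iff, Set.mem_empty_iff_false, iff_false]
      rintro ⟨rfl, h'⟩
      exact h h'.symm]
    simp

theorem genFun_cons (t : ℕ) (S : Set (List ℕ)) :
    genFun wt (List.cons t '' S) = MvPowerSeries.monomial (wt t) 1 * genFun wt S := by
  ext e
  rw [MvPowerSeries.coeff_monomial_mul, coeff_genFun, coeff_genFun, one_mul]
  split_ifs with h
  · congr 1
    rw [← Set.ncard_image_of_injective {l | l ∈ S ∧ (l.map wt).sum = e - wt t}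
      (List.cons_injective (a := t))]
    congr 1
    ext l
    simp only [Set.mem_ofPred_eq, Set.mem_image]
    constructor
    · rintro ⟨⟨l, hl, rfl⟩, h'⟩
      refine ⟨l, ⟨hl, ?_⟩, rfl⟩
      rw [← h', List.map_cons, List.sum_cons, add_tsub_cancel_left]
    · rintro ⟨l, ⟨hl, h'⟩, rfl⟩
      refine ⟨⟨l, hl, rfl⟩, ?_⟩
      rw [List.map_cons, List.sum_cons, h', add_tsub_cancel_of_le h]
  · rw [Nat.cast_eq_zero]
    convert Set.ncard_empty (List ℕ)
    ext l
    simp only [Set.mem_ofPred_eq, Set.mem_image, Set.mem_empty_iff_false, iff_false]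
    rintro ⟨⟨l, hl, rfl⟩, rfl⟩
    exact h (by simp)

/-- The words with letters in `P` whose consecutive letters are related by `R`. -/
def chains (P : ℕ → Prop) (R : ℕ → ℕ → Prop) : Set (List ℕ) :=
  {l | (∀ t ∈ l, P t) ∧ l.IsChain R}

/-- The chains with first letter `t`. -/
def chainsFrom (P : ℕ → Prop) (R : ℕ → ℕ → Prop) (t : ℕ) : Set (List ℕ) :=
  {l | l ∈ chains P R ∧ l.head? = some t}

variable {P : ℕ → Prop} {R : ℕ → ℕ → Prop}

theorem genFun_head_mem (hwt : ∀ t, t < 4 * wt t 0) (T : Finset ℕ) :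
    genFun wt {l | l ∈ chains P R ∧ ∀ t ∈ l.head?, t ∈ T} =
      1 + ∑ t ∈ T, genFun wt (chainsFrom P R t) := by
  induction T using Finset.induction_on with
  | empty =>
    rw [Finset.sum_empty, add_zero, ← genFun_singleton_nil (wt := wt)]
    congr 1
    ext l
    cases l <;> simp [chains]
  | insert a T ha ih =>
    rw [Finset.sum_insert ha, add_left_comm, ← ih, ← genFun_union hwt]
    · congr 1
      ext l
      cases l with
      | nil => simp [chains, chainsFrom]
      | cons s l =>
        simp only [Set.mem_ofPred_eq, Set.mem_union, chainsFrom, List.head?_cons,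
          Option.mem_def, Option.some.injEq, forall_eq', Finset.mem_insert]
        tauto
    · rw [Set.disjoint_left]
      rintro l ⟨_, hl⟩ ⟨_, hl'⟩
      exact ha (hl' a hl)

/-- Transfer step: strip the first letter; what is left is empty or starts with an allowed
successor. -/
theorem genFun_chainsFrom (hwt : ∀ t, t < 4 * wt t 0) (t : ℕ) (hP : P t) (T : Finset ℕ)
    (hT : ∀ s, s ∈ T ↔ R t s) :
    genFun wt (chainsFrom P R t) =
      MvPowerSeries.monomial (wt t) 1 * (1 + ∑ s ∈ T, genFun wt (chainsFrom P R s)) := by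
  rw [← genFun_head_mem hwt, ← genFun_cons]
  congr 1
  ext l
  cases l with
  | nil => simp [chainsFrom]
  | cons s l =>
    simp only [chainsFrom, chains, Set.mem_ofPred_eq, List.head?_cons, Option.some.injEq,
      Set.mem_image, List.cons.injEq, List.mem_cons, forall_eq_or_imp, List.isChain_cons, hT]
    constructor
    · rintro ⟨⟨⟨h1, h2⟩, h3, h4⟩, rfl⟩
      exact ⟨l, ⟨⟨h2, h4⟩, h3⟩, rfl, rfl⟩
    · rintro ⟨l', ⟨⟨h2, h4⟩, h3⟩, rfl, rfl⟩
      exact ⟨⟨⟨hP, h2⟩, h3, h4⟩, rfl⟩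

theorem genFun_chainsFrom_of_not (t : ℕ) (hP : ¬ P t) : genFun wt (chainsFrom P R t) = 0 := by
  rw [← genFun_empty (wt := wt)]
  congr 1
  ext l
  simp only [chainsFrom, chains, Set.mem_ofPred_eq, Set.mem_empty_iff_false, iff_false]
  rintro ⟨⟨h, _⟩, ht⟩
  exact hP (h t (List.mem_of_mem_head? ht))

/-- The generating function of the chains with first letter below `N`. -/
noncomputable def below (wt : ℕ → Fin 3 →₀ ℕ) (P : ℕ → Prop) (R : ℕ → ℕ → Prop) (N : ℕ) : QAD :=
  1 + ∑ t ∈ Finset.range N, genFun wt (chainsFrom P R t)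

theorem below_succ (N : ℕ) :
    below wt P R (N + 1) = below wt P R N + genFun wt (chainsFrom P R N) := by
  rw [below, below, Finset.sum_range_succ, add_assoc]

theorem coeff_below (hwt : ∀ t, t < 4 * wt t 0) {N : ℕ} {e : Fin 3 →₀ ℕ} (hN : 4 * e 0 ≤ N) :
    MvPowerSeries.coeff e (below wt P R N) = MvPowerSeries.coeff e (genFun wt (chains P R)) := by
  rw [below, ← genFun_head_mem hwt, coeff_genFun, coeff_genFun]
  congr 2
  ext l
  simp only [Set.mem_ofPred_eq, Finset.mem_range, and_assoc, and_congr_right_iff,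
    and_iff_right_iff_imp]
  intro _ hl t ht
  exact (lt_of_mem_of_sum_eq hwt hl (List.mem_of_mem_head? ht)).trans_le hN

end WordCount

/-! ### Partitions as words of positions -/

namespace P3Part

/-- The enumeration `2, 3, 3', 4, 5, 6, 6', 7, …` of the parts other than 1. -/
def nth (t : ℕ) : P3Part where
  size := if t % 4 = 0 then 3 * (t / 4) + 2 else if t % 4 = 3 then 3 * (t / 4) + 4
    else 3 * (t / 4) + 3
  primed := decide (t % 4 = 2)
  pos := by split_ifs <;> omega
  dvd_of_primed := by
    intro h
    have := of_decide_eq_true h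
    split_ifs <;> omega

theorem size_nth (t : ℕ) : (nth t).size = if t % 4 = 0 then 3 * (t / 4) + 2
    else if t % 4 = 3 then 3 * (t / 4) + 4 else 3 * (t / 4) + 3 := rfl

theorem primed_nth (t : ℕ) : (nth t).primed = true ↔ t % 4 = 2 := by
  simp [nth]

theorem nth_injective : Function.Injective nth := by
  intro s t h
  have h1 := congrArg size h
  have h2 : (nth s).primed = true ↔ (nth t).primed = true := by rw [h]
  rw [primed_nth, primed_nth] at h2
  rw [size_nth, size_nth] at h1
  split_ifs at h1 <;> omega

theorem exists_nth_eq {x : P3Part} (hx : x.size ≠ 1) : ∃ t, nth t = x := by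
  have hpos := x.pos
  have hd := x.dvd_of_primed
  have key : ∀ t, (nth t).size = x.size → ((nth t).primed = true ↔ x.primed = true) →
      ∃ t, nth t = x := fun t h1 h2 => ⟨t, P3Part.ext h1 (Bool.eq_iff_iff.mpr h2)⟩
  by_cases hp : x.primed = true
  · have := hd hp
    refine key (4 * (x.size / 3 - 1) + 2) ?_ ?_
    · rw [size_nth]
      split_ifs <;> omega
    · rw [primed_nth]
      simp only [hp, iff_true]
      omega
  · have h3 : x.size % 3 = 0 ∨ x.size % 3 = 1 ∨ x.size % 3 = 2 := by omega
    rcases h3 with h | h | h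
    · refine key (4 * (x.size / 3 - 1) + 1) ?_ ?_
      · rw [size_nth]
        split_ifs <;> omega
      · rw [primed_nth]
        rw [iff_false_right hp]
        omega
    · refine key (4 * (x.size / 3 - 1) + 3) ?_ ?_
      · rw [size_nth]
        split_ifs <;> omega
      · rw [primed_nth]
        rw [iff_false_right hp]
        omega
    · refine key (4 * (x.size / 3)) ?_ ?_
      · rw [size_nth]
        split_ifs <;> omega
      · rw [primed_nth]
        rw [iff_false_right hp]
        omega

theorem size_nth_ne_one (t : ℕ) : (nth t).size ≠ 1 := by
  rw [size_nth]
  split_ifs <;> omega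

/-- The exponents of `q`, `a` and `d` contributed by a part. -/
noncomputable def stat (x : P3Part) : Fin 3 →₀ ℕ :=
  Finsupp.single 0 x.size + Finsupp.single 1 (if x.size ≡ 2 [MOD 3] then 1 else 0) +
    Finsupp.single 2 (if x.size ≡ 1 [MOD 3] then 1 else 0)

theorem lt_four_mul_stat_nth (t : ℕ) : t < 4 * (nth t).stat 0 := by
  have : (nth t).stat 0 = (nth t).size := by simp [stat]
  rw [this, size_nth]
  split_ifs <;> omega

/-- The order on parts that is used to list a partition. -/
def Le (y x : P3Part) : Prop :=
  y.size < x.size ∨ (y.size = x.size ∧ (y.primed = true → x.primed = true))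

theorem le_nth_iff (s t : ℕ) : Le (nth t) (nth s) ↔ t ≤ s := by
  unfold Le
  rw [primed_nth, primed_nth, size_nth, size_nth]
  split_ifs <;> omega

end P3Part

theorem List.isChain_and_iff {α : Type*} {R S : α → α → Prop} {l : List α} :
    l.IsChain (fun x y => R x y ∧ S x y) ↔ l.IsChain R ∧ l.IsChain S := by
  induction l with
  | nil => simp
  | cons a l ih =>
    simp only [List.isChain_cons, ih]
    constructor
    · rintro ⟨h, h1, h2⟩
      exact ⟨⟨fun y hy => (h y hy).1, h1⟩, fun y hy => (h y hy).2, h2⟩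
    · rintro ⟨⟨h, h1⟩, h', h2⟩
      exact ⟨fun y hy => ⟨h y hy, h' y hy⟩, h1, h2⟩

namespace P3Partition

theorem sum_stat (p : P3Partition) :
    (p.parts.map P3Part.stat).sum =
      Finsupp.single 0 p.weight + Finsupp.single 1 (p.numParts 2 3) +
        Finsupp.single 2 (p.numParts 1 3) := by
  obtain ⟨l, h⟩ := p
  simp only [weight, numParts]
  clear h
  induction l with
  | nil => simp
  | cons x l ih =>
    simp only [List.map_cons, List.sum_cons, ih, List.countP_cons, P3Part.stat, Finsupp.single_add,
      decide_eq_true_eq]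
    abel

theorem sum_stat_eq_iff (p : P3Partition) (e : Fin 3 →₀ ℕ) :
    (p.parts.map P3Part.stat).sum = e ↔
      p.weight = e 0 ∧ p.numParts 2 3 = e 1 ∧ p.numParts 1 3 = e 2 := by
  rw [sum_stat, Finsupp.ext_iff]
  constructor
  · intro h
    have h0 := h 0
    have h1 := h 1
    have h2 := h 2
    simp at h0 h1 h2
    exact ⟨h0, h1, h2⟩
  · rintro ⟨h0, h1, h2⟩ i
    fin_cases i <;> simp [h0, h1, h2]

/-- A class of partitions without the part 1 corresponds to a set of words by the enumeration
`P3Part.nth` of the other parts. -/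
theorem ncard_eq_ncard_words {C : P3Partition → Prop} {S : Set (List ℕ)}
    (hC : ∀ p, C p → ∀ x ∈ p.parts, x.size ≠ 1)
    (hS : ∀ (l : List ℕ) (p : P3Partition), p.parts = l.map P3Part.nth → (C p ↔ l ∈ S))
    (hS' : ∀ l ∈ S, l.IsChain fun s t => t ≤ s) (e : Fin 3 →₀ ℕ) :
    {p : P3Partition | C p ∧ (p.parts.map P3Part.stat).sum = e}.ncard =
      {l : List ℕ | l ∈ S ∧ (l.map fun t => (P3Part.nth t).stat).sum = e}.ncard := by
  have hinj : Function.Injective P3Partition.parts := fun p r h => P3Partition.ext h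
  rw [← Set.ncard_image_of_injective _ hinj,
    ← Set.ncard_image_of_injective _ (List.map_injective_iff.mpr P3Part.nth_injective)]
  congr 1
  ext L
  constructor
  · rintro ⟨p, ⟨hp, he⟩, rfl⟩
    obtain ⟨l, hl⟩ : ∃ l : List ℕ, l.map P3Part.nth = p.parts := by
      have := hC p hp
      generalize p.parts = L at this
      induction L with
      | nil => exact ⟨[], rfl⟩
      | cons x L ih =>
        obtain ⟨l, rfl⟩ := ih fun y hy => this y (List.mem_cons_of_mem _ hy)
        obtain ⟨t, rfl⟩ := P3Part.exists_nth_eq (this x List.mem_cons_self)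
        exact ⟨t :: l, rfl⟩
    refine ⟨l, ⟨(hS l p hl.symm).mp hp, ?_⟩, hl⟩
    rw [← he, ← hl, List.map_map]
    rfl
  · rintro ⟨l, ⟨hl, he⟩, rfl⟩
    have hc := hS' l hl
    have hsorted : (l.map P3Part.nth).Pairwise fun x y => P3Part.Le y x := by
      have : IsTrans ℕ fun s t => t ≤ s := ⟨fun a b c h h' => h'.trans h⟩
      rw [List.pairwise_map]
      exact (List.isChain_iff_pairwise.mp hc).imp fun {s t} h => (P3Part.le_nth_iff s t).mpr h
    refine ⟨⟨l.map P3Part.nth, hsorted⟩, ⟨(hS l _ rfl).mpr hl, ?_⟩, rfl⟩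
    rw [← he, List.map_map]
    rfl

/-- The difference conditions, for parts given by their position in the enumeration. -/
def RelA (s t : ℕ) : Prop :=
  (s % 4 = 0 ∧ (t + 4 < s ∨ t + 3 = s)) ∨ (s % 4 = 1 ∧ (t = s ∨ t + 1 < s)) ∨
    (s % 4 = 2 ∧ (t = s ∨ t + 2 = s ∨ (t + 2 < s ∧ t + 3 ≠ s))) ∨
    (s % 4 = 3 ∧ (t + 1 = s ∨ t + 3 = s ∨ (t + 3 < s ∧ t + 4 ≠ s)))

theorem residue_nth (t : ℕ) : (P3Part.nth t).residue =
    if t % 4 = 0 then P3Residue.two else if t % 4 = 1 then P3Residue.zero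
    else if t % 4 = 2 then P3Residue.zeroPrimed else P3Residue.one := by
  unfold P3Part.residue
  simp only [P3Part.primed_nth, P3Part.size_nth]
  split_ifs <;> first | rfl | omega

/-- The listing order becomes `t ≤ s`, and each pair of classes modulo 4 turns the gap conditions
into a linear condition on positions. -/
theorem relA_iff (s t : ℕ) :
    (t ≤ s ∧ (Gap3 (P3Part.nth s) (P3Part.nth t) →
        (3 : ℤ) ≤ ((P3Part.nth s).size : ℤ) - ((P3Part.nth t).size : ℤ)) ∧
      (Gap4 (P3Part.nth s) (P3Part.nth t) →
        (4 : ℤ) ≤ ((P3Part.nth s).size : ℤ) - ((P3Part.nth t).size : ℤ))) ↔ RelA s t := by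
  unfold Gap3 Gap4 RelA Int.ModEq
  simp only [residue_nth, P3Part.size_nth]
  have hs : s % 4 = 0 ∨ s % 4 = 1 ∨ s % 4 = 2 ∨ s % 4 = 3 := by omega
  have ht : t % 4 = 0 ∨ t % 4 = 1 ∨ t % 4 = 2 ∨ t % 4 = 3 := by omega
  rcases hs with hs | hs | hs | hs <;> rcases ht with ht | ht | ht | ht <;>
    simp [hs, ht] <;> omega

theorem isA3_iff {l : List ℕ} {p : P3Partition} (h : p.parts = l.map P3Part.nth) :
    p.IsA3 ↔ l ∈ WordCount.chains (fun _ => True) RelA := by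
  have hsorted : l.IsChain fun s t => t ≤ s := by
    have := p.sorted
    rw [h, List.pairwise_map] at this
    exact this.isChain.imp fun s t hst => (P3Part.le_nth_iff s t).mp hst
  rw [IsA3, h, List.isChain_map]
  simp only [WordCount.chains, Set.mem_ofPred_eq, implies_true, true_and, List.mem_map,
    forall_exists_index, and_imp, forall_apply_eq_imp_iff₂, P3Part.size_nth_ne_one, ne_eq,
    not_false_eq_true]
  rw [← List.IsChain.iff relA_iff, List.isChain_and_iff (R := fun s t => t ≤ s), and_iff_right hsorted]

/-- The letters of the partitions that satisfy the congruence conditions. -/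
def LetterB (t : ℕ) : Prop := t % 4 = 1 ∨ t % 4 = 2 ∨ t % 8 = 0 ∨ t % 8 = 3

/-- Only ordinary multiples of 3 may repeat. -/
def RelB (s t : ℕ) : Prop := t < s ∨ (t = s ∧ s % 4 = 1)

/-- `RelB` is transitive, so this pairwise condition can be tested on neighbours, as the word count
requires. -/
theorem isB3_iff {l : List ℕ} {p : P3Partition} (h : p.parts = l.map P3Part.nth) :
    p.IsB3 ↔ l ∈ WordCount.chains LetterB RelB := by
  have hsorted : l.Pairwise fun s t => t ≤ s := by
    have := p.sorted
    rw [h, List.pairwise_map] at this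
    exact this.imp fun {s t} hst => (P3Part.le_nth_iff s t).mp hst
  have htrans : IsTrans ℕ RelB := ⟨fun a b c h h' => by unfold RelB at *; omega⟩
  have h1 : ∀ t, (¬ 3 ∣ (P3Part.nth t).size →
      (P3Part.nth t).size ≡ 2 [MOD 6] ∨ (P3Part.nth t).size ≡ 4 [MOD 6]) ↔ LetterB t := by
    intro t
    rw [P3Part.size_nth]
    unfold LetterB Nat.ModEq
    split_ifs <;> omega
  have h2 : ∀ s t, t ≤ s ∧ (P3Part.nth s = P3Part.nth t →
      3 ∣ (P3Part.nth s).size ∧ (P3Part.nth s).primed = false) ↔ RelB s t := by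
    intro s t
    rw [P3Part.nth_injective.eq_iff, ← Bool.not_eq_true, P3Part.primed_nth, P3Part.size_nth]
    unfold RelB
    split_ifs <;> omega
  rw [IsB3, h, List.pairwise_map]
  simp only [WordCount.chains, Set.mem_ofPred_eq, List.mem_map, forall_exists_index, and_imp,
    forall_apply_eq_imp_iff₂, h1]
  rw [List.isChain_iff_pairwise]
  refine and_congr_right fun _ => ?_
  rw [← List.Pairwise.iff fun {s t} => h2 s t, List.pairwise_and_iff, and_iff_right hsorted]

theorem IsB3.size_ne_one {p : P3Partition} (h : p.IsB3) : ∀ x ∈ p.parts, x.size ≠ 1 := by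
  intro x hx h1
  have := h.1 x hx (by rw [h1]; decide)
  rw [h1] at this
  rcases this with h | h <;> exact absurd h (by decide)

/-- The classes 2 and 4 modulo 6 are the only ones allowed off the multiples of 3, so residues
modulo 3 detect them and the same `stat` serves A and B. -/
theorem IsB3.numParts_eq {p : P3Partition} (h : p.IsB3) :
    p.numParts 2 6 = p.numParts 2 3 ∧ p.numParts 4 6 = p.numParts 1 3 := by
  constructor <;>
  · refine List.countP_congr fun x hx => ?_
    have := h.1 x hx
    rw [decide_eq_true_eq, decide_eq_true_eq]
    unfold Nat.ModEq at *
    omega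

theorem A3_eq (e : Fin 3 →₀ ℕ) : (A3 (e 0) (e 1) (e 2) : ℚ) =
    MvPowerSeries.coeff e (WordCount.genFun (fun t => (P3Part.nth t).stat)
      (WordCount.chains (fun _ => True) RelA)) := by
  rw [WordCount.coeff_genFun, ← ncard_eq_ncard_words (C := IsA3) (fun p hp => hp.1)
    (fun l p h => isA3_iff h) (fun l hl => hl.2.imp fun s t h => ((relA_iff s t).mpr h).1), A3]
  congr 2
  ext p
  simp only [Set.mem_ofPred_eq, sum_stat_eq_iff]
  tauto

theorem B3_eq (e : Fin 3 →₀ ℕ) : (B3 (e 0) (e 1) (e 2) : ℚ) =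
    MvPowerSeries.coeff e (WordCount.genFun (fun t => (P3Part.nth t).stat)
      (WordCount.chains LetterB RelB)) := by
  rw [WordCount.coeff_genFun, ← ncard_eq_ncard_words (C := IsB3) (fun p hp => hp.size_ne_one)
    (fun l p h => isB3_iff h) (fun l hl => hl.2.imp fun s t h => by unfold RelB at h; omega), B3]
  congr 2
  ext p
  simp only [Set.mem_ofPred_eq, sum_stat_eq_iff]
  constructor
  · rintro ⟨h1, h2, h3, h4⟩
    exact ⟨h2, h1, h2.numParts_eq.1 ▸ h3, h2.numParts_eq.2 ▸ h4⟩
  · rintro ⟨h2, h1, h3, h4⟩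
    exact ⟨h1, h2, h2.numParts_eq.1 ▸ h3, h2.numParts_eq.2 ▸ h4⟩

end P3Partition

/-! ### Level equations for A, finite products for B -/

namespace P3Partition

open WordCount QAD

theorem monomial_stat (x : P3Part) : (MvPowerSeries.monomial x.stat 1 : QAD) =
    q ^ x.size * a ^ (if x.size ≡ 2 [MOD 3] then 1 else 0) *
      d ^ (if x.size ≡ 1 [MOD 3] then 1 else 0) := by
  rw [q, a, d, MvPowerSeries.X_pow_eq, MvPowerSeries.X_pow_eq, MvPowerSeries.X_pow_eq,
    MvPowerSeries.monomial_mul_monomial, MvPowerSeries.monomial_mul_monomial, one_mul, one_mul]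
  rfl

theorem monomial_stat_nth_zero (k : ℕ) :
    (MvPowerSeries.monomial (P3Part.nth (4 * k)).stat 1 : QAD) = a * q ^ 2 * (q ^ 3) ^ k := by
  have h : (P3Part.nth (4 * k)).size = 3 * k + 2 := by
    rw [P3Part.size_nth]
    split_ifs <;> omega
  rw [monomial_stat, h, if_pos (by unfold Nat.ModEq; omega), if_neg (by unfold Nat.ModEq; omega)]
  ring

theorem monomial_stat_nth_one (k : ℕ) :
    (MvPowerSeries.monomial (P3Part.nth (4 * k + 1)).stat 1 : QAD) = (q ^ 3) ^ (k + 1) := by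
  have h : (P3Part.nth (4 * k + 1)).size = 3 * k + 3 := by
    rw [P3Part.size_nth]
    split_ifs <;> omega
  rw [monomial_stat, h, if_neg (by unfold Nat.ModEq; omega), if_neg (by unfold Nat.ModEq; omega)]
  ring

theorem monomial_stat_nth_two (k : ℕ) :
    (MvPowerSeries.monomial (P3Part.nth (4 * k + 2)).stat 1 : QAD) = (q ^ 3) ^ (k + 1) := by
  have h : (P3Part.nth (4 * k + 2)).size = 3 * k + 3 := by
    rw [P3Part.size_nth]
    split_ifs <;> omega
  rw [monomial_stat, h, if_neg (by unfold Nat.ModEq; omega), if_neg (by unfold Nat.ModEq; omega)]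
  ring

theorem monomial_stat_nth_three (k : ℕ) :
    (MvPowerSeries.monomial (P3Part.nth (4 * k + 3)).stat 1 : QAD) = d * q ^ 4 * (q ^ 3) ^ k := by
  have h : (P3Part.nth (4 * k + 3)).size = 3 * k + 4 := by
    rw [P3Part.size_nth]
    split_ifs <;> omega
  rw [monomial_stat, h, if_neg (by unfold Nat.ModEq; omega), if_pos (by unfold Nat.ModEq; omega)]
  ring

/-- The generating function of the partitions satisfying the difference conditions with largest part
at position `t`. -/
noncomputable def genA (t : ℕ) : QAD :=
  genFun (fun t => (P3Part.nth t).stat) (chainsFrom (fun _ => True) RelA t)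

/-- The generating function of the partitions satisfying the difference conditions with all parts at
positions below `N`. -/
noncomputable def belowA (N : ℕ) : QAD :=
  below (fun t => (P3Part.nth t).stat) (fun _ => True) RelA N

theorem belowA_eq (N : ℕ) : belowA N = 1 + ∑ t ∈ Finset.range N, genA t := rfl

theorem belowA_succ (N : ℕ) : belowA (N + 1) = belowA N + genA N := below_succ N

theorem genA_eq (t : ℕ) (T : Finset ℕ) (hT : ∀ s, s ∈ T ↔ RelA t s) :
    genA t = MvPowerSeries.monomial (P3Part.nth t).stat 1 * (1 + ∑ s ∈ T, genA s) :=
  genFun_chainsFrom P3Part.lt_four_mul_stat_nth t trivial T hT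

theorem levelSystem : LevelSystem (q ^ 3) (a * q ^ 2) (d * q ^ 4) (fun k => genA (4 * k))
    (fun k => genA (4 * k + 1)) (fun k => genA (4 * k + 2)) (fun k => genA (4 * k + 3))
    (fun k => belowA (4 * k)) where
  G_zero := by simp [belowA_eq]
  G_succ k := by
    rw [show 4 * (k + 1) = 4 * k + 1 + 1 + 1 + 1 by ring, belowA_succ, belowA_succ, belowA_succ,
      belowA_succ]
  a_zero := by
    rw [genA_eq _ ∅ fun s => by simp [RelA], monomial_stat_nth_zero]
    simp
  a_succ k := by
    rw [genA_eq _ (insert (4 * k + 1) (Finset.range (4 * k))) fun s => by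
        simp only [Finset.mem_insert, Finset.mem_range, RelA]; omega,
      monomial_stat_nth_zero, Finset.sum_insert (by simp), belowA_eq]
    ring
  b_eq k := by
    conv_lhs =>
      rw [genA_eq _ (insert (4 * k + 1) (Finset.range (4 * k))) fun s => by
          simp only [Finset.mem_insert, Finset.mem_range, RelA]; omega,
        monomial_stat_nth_one, Finset.sum_insert (by simp)]
    rw [belowA_eq]
    ring
  c_zero := by
    conv_lhs =>
      rw [genA_eq (4 * 0 + 2) {0, 2} fun s => by
          simp only [Finset.mem_insert, Finset.mem_singleton]; unfold RelA; omega,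
        monomial_stat_nth_two, Finset.sum_pair (by decide)]
    simp only [belowA_eq, mul_zero, Finset.range_zero, Finset.sum_empty, zero_add]
    ring
  c_succ k := by
    conv_lhs =>
      rw [genA_eq _ (insert (4 * k + 6) (insert (4 * k + 4) (Finset.range (4 * k + 3)))) fun s => by
          simp only [Finset.mem_insert, Finset.mem_range, RelA]; omega,
        monomial_stat_nth_two, Finset.sum_insert (by simp), Finset.sum_insert (by simp)]
    -- The range stops at 4k + 3, the residue-1 part one level down, which may not follow; hence G
    -- (k + 1) minus its series.
    rw [show 4 * (k + 1) = 4 * k + 3 + 1 by ring, belowA_succ, belowA_eq]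
    ring
  d_zero := by
    rw [genA_eq (4 * 0 + 3) {0, 2} fun s => by
        simp only [Finset.mem_insert, Finset.mem_singleton]; unfold RelA; omega,
      monomial_stat_nth_three, Finset.sum_pair (by decide)]
    simp only [belowA_eq, mul_zero, Finset.range_zero, Finset.sum_empty, zero_add]
    ring
  d_succ k := by
    rw [genA_eq _ (insert (4 * k + 6) (insert (4 * k + 4) (Finset.range (4 * k + 3)))) fun s => by
        simp only [Finset.mem_insert, Finset.mem_range, RelA]; omega,
      monomial_stat_nth_three, Finset.sum_insert (by simp), Finset.sum_insert (by simp)]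
    rw [show 4 * (k + 1) = 4 * k + 3 + 1 by ring, belowA_succ, belowA_eq]
    ring

/-- The generating function of the partitions satisfying the congruence conditions with largest part
at position `t`. -/
noncomputable def genB (t : ℕ) : QAD :=
  genFun (fun t => (P3Part.nth t).stat) (chainsFrom LetterB RelB t)

/-- The generating function of the partitions satisfying the congruence conditions with all parts at
positions below `N`. -/
noncomputable def belowB (N : ℕ) : QAD :=
  below (fun t => (P3Part.nth t).stat) LetterB RelB N

theorem belowB_eq (N : ℕ) : belowB N = 1 + ∑ t ∈ Finset.range N, genB t := rfl

theorem belowB_succ (N : ℕ) : belowB (N + 1) = belowB N + genB N := below_succ N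

theorem genB_eq (t : ℕ) (ht : LetterB t) (T : Finset ℕ) (hT : ∀ s, s ∈ T ↔ RelB t s) :
    genB t = MvPowerSeries.monomial (P3Part.nth t).stat 1 * (1 + ∑ s ∈ T, genB s) :=
  genFun_chainsFrom P3Part.lt_four_mul_stat_nth t ht T hT

theorem belowB_succ_of_distinct (t : ℕ) (ht : LetterB t) (h1 : t % 4 ≠ 1) :
    belowB (t + 1) = (1 + MvPowerSeries.monomial (P3Part.nth t).stat 1) * belowB t := by
  rw [belowB_succ, genB_eq t ht (Finset.range t) fun s => by
    rw [Finset.mem_range, RelB]; omega, belowB_eq]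
  ring

theorem belowB_succ_of_repeatable (t : ℕ) (h1 : t % 4 = 1) :
    (1 - MvPowerSeries.monomial (P3Part.nth t).stat 1) * belowB (t + 1) = belowB t := by
  have h := genB_eq t (Or.inl h1) (insert t (Finset.range t)) fun s => by
    rw [Finset.mem_insert, Finset.mem_range, RelB]; omega
  rw [Finset.sum_insert (by simp)] at h
  rw [belowB_succ, belowB_eq]
  linear_combination h

theorem belowB_succ_of_not (t : ℕ) (ht : ¬ LetterB t) : belowB (t + 1) = belowB t := by
  rw [belowB_succ, genB, genFun_chainsFrom_of_not t ht, add_zero]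

/-- Parts 3k + 2 and 3k + 4 are 2 and 4 modulo 6 exactly when k is even; odd levels hold only the
two kinds of 3k + 3. -/
theorem belowB_level (k : ℕ) :
    (1 - (q ^ 3) ^ (k + 1)) * belowB (4 * k + 4) =
      (1 + if k % 2 = 0 then d * q ^ 4 * (q ^ 3) ^ k else 0) * (1 + (q ^ 3) ^ (k + 1)) *
        (1 + if k % 2 = 0 then a * q ^ 2 * (q ^ 3) ^ k else 0) * belowB (4 * k) := by
  have h0 : belowB (4 * k + 1) =
      (1 + if k % 2 = 0 then a * q ^ 2 * (q ^ 3) ^ k else 0) * belowB (4 * k) := by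
    split_ifs with h
    · rw [belowB_succ_of_distinct _ (by unfold LetterB; omega) (by omega), monomial_stat_nth_zero]
    · rw [belowB_succ_of_not _ (by unfold LetterB; omega), add_zero, one_mul]
  have h1 := belowB_succ_of_repeatable (4 * k + 1) (by omega)
  rw [monomial_stat_nth_one] at h1
  have h2 := belowB_succ_of_distinct (4 * k + 2) (by unfold LetterB; omega) (by omega)
  rw [monomial_stat_nth_two] at h2
  have h3 : belowB (4 * k + 4) =
      (1 + if k % 2 = 0 then d * q ^ 4 * (q ^ 3) ^ k else 0) * belowB (4 * k + 3) := by
    split_ifs with h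
    · rw [belowB_succ_of_distinct _ (by unfold LetterB; omega) (by omega), monomial_stat_nth_three]
    · rw [belowB_succ_of_not _ (by unfold LetterB; omega), add_zero, one_mul]
  rw [h3, h2, mul_assoc, mul_assoc, ← h0, ← h1]
  ring

theorem belowB_eq_prod (m : ℕ) :
    (∏ k ∈ Finset.range (2 * m), (1 - q ^ 3 * (q ^ 3) ^ k)) * belowB (4 * (2 * m)) =
      (∏ k ∈ Finset.range m, (1 - -(a * q ^ 2) * (q ^ 6) ^ k)) *
        (∏ k ∈ Finset.range m, (1 - -(d * q ^ 4) * (q ^ 6) ^ k)) *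
        ∏ k ∈ Finset.range (2 * m), (1 - -q ^ 3 * (q ^ 3) ^ k) := by
  induction m with
  | zero => simp [belowB_eq]
  | succ m ih =>
    have h0 := belowB_level (2 * m)
    have h1 := belowB_level (2 * m + 1)
    rw [if_pos (by omega), if_pos (by omega)] at h0
    rw [if_neg (by omega), if_neg (by omega)] at h1
    rw [show 2 * (m + 1) = 2 * m + 1 + 1 by ring, Finset.prod_range_succ, Finset.prod_range_succ,
      Finset.prod_range_succ _ (2 * m + 1), Finset.prod_range_succ _ (2 * m),
      Finset.prod_range_succ _ m, Finset.prod_range_succ _ m]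
    rw [show 4 * (2 * m + 1) + 4 = 4 * (2 * m + 1 + 1) by ring] at h1
    rw [show 4 * (2 * m) + 4 = 4 * (2 * m + 1) by ring] at h0
    generalize belowB (4 * (2 * m)) = b0 at *
    generalize belowB (4 * (2 * m + 1)) = b1 at *
    generalize belowB (4 * (2 * m + 1 + 1)) = b2 at *
    generalize (∏ k ∈ Finset.range (2 * m), (1 - q ^ 3 * (q ^ 3) ^ k)) = p0 at *
    linear_combination p0 * (1 - (q ^ 3) ^ (2 * m + 1)) * h1 +
      p0 * (1 + (q ^ 3) ^ (2 * m + 2)) * h0 +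
      (1 + d * q ^ 4 * (q ^ 3) ^ (2 * m)) * (1 + (q ^ 3) ^ (2 * m + 1)) *
        (1 + a * q ^ 2 * (q ^ 3) ^ (2 * m)) * (1 + (q ^ 3) ^ (2 * m + 2)) * ih

end P3Partition

/-! ### Limits of power series and a telescoping summation -/

namespace QAD

open Filter
open scoped Topology MvPowerSeries.WithPiTopology

theorem dvd_iff_coeff {N : ℕ} {z : QAD} :
    q ^ N ∣ z ↔ ∀ e : Fin 3 →₀ ℕ, e 0 < N → MvPowerSeries.coeff e z = 0 :=
  MvPowerSeries.X_pow_dvd_iff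

theorem pow_dvd_pow_of_le {Q : QAD} (hQ : q ∣ Q) {N n : ℕ} (h : N ≤ n) : q ^ N ∣ Q ^ n :=
  (pow_dvd_pow q h).trans (pow_dvd_pow_of_dvd hQ n)

theorem constantCoeff_eq_zero {z : QAD} (hz : q ∣ z) : MvPowerSeries.constantCoeff z = 0 := by
  obtain ⟨w, rfl⟩ := hz
  simp [q]

theorem one_sub_ne_zero {z : QAD} (hz : q ∣ z) : 1 - z ≠ 0 := by
  intro h
  have := congrArg MvPowerSeries.constantCoeff h
  simp [constantCoeff_eq_zero hz] at this

theorem inv_one_sub_mul {z : QAD} (hz : q ∣ z) : (1 - z)⁻¹ * (1 - z) = 1 :=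
  MvPowerSeries.inv_mul_cancel _ (by simp [constantCoeff_eq_zero hz])

/-- Congruence modulo every power of q makes each coefficient eventually constant. -/
theorem tendsto_of_dvd {u : ℕ → QAD} {v : QAD} (h : ∀ N, ∃ K, ∀ k ≥ K, q ^ N ∣ u k - v) :
    Tendsto u atTop (𝓝 v) := by
  rw [MvPowerSeries.WithPiTopology.tendsto_iff_coeff_tendsto]
  intro e
  obtain ⟨K, hK⟩ := h (e 0 + 1)
  refine tendsto_const_nhds.congr' ?_
  filter_upwards [eventually_ge_atTop K] with k hk
  have := dvd_iff_coeff.mp (hK k hk) e (Nat.lt_succ_self _)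
  rw [map_sub, sub_eq_zero] at this
  exact this.symm

theorem dvd_sub_of_tendsto {u : ℕ → QAD} {v w : QAD} {N : ℕ} (h : Tendsto u atTop (𝓝 v))
    (hu : ∀ᶠ k in atTop, q ^ N ∣ u k - w) : q ^ N ∣ v - w := by
  rw [dvd_iff_coeff]
  intro e he
  rw [map_sub, sub_eq_zero]
  refine tendsto_nhds_unique
    ((MvPowerSeries.WithPiTopology.tendsto_iff_coeff_tendsto _ _ _).mp h e) ?_
  refine tendsto_const_nhds.congr' ?_
  filter_upwards [hu] with k hk
  have := dvd_iff_coeff.mp hk e he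
  rw [map_sub, sub_eq_zero] at this
  exact this.symm

theorem summable_of_dvd {ι : Type*} {f : ι → QAD} (h : ∀ N, {i | ¬ q ^ N ∣ f i}.Finite) :
    Summable f := by
  rw [MvPowerSeries.WithPiTopology.summable_iff_summable_coeff]
  intro e
  refine summable_of_hasFiniteSupport ((h (e 0 + 1)).subset fun i hi hd => hi ?_)
  exact dvd_iff_coeff.mp hd e (Nat.lt_succ_self _)

theorem tendsto_qPoch {z w : QAD} (hw : q ∣ w) :
    Tendsto (fun m => ∏ k ∈ Finset.range m, (1 - z * w ^ k)) atTop (𝓝 (qPoch z w)) :=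
  (multipliable_qPoch z w (constantCoeff_eq_zero hw)).tendsto_prod_tprod_nat

theorem t3Space : T3Space QAD :=
  inferInstanceAs (T3Space ((Fin 3 →₀ ℕ) → ℚ))

/-- The solution of `u (i + 1) * (1 - p ^ (i + 1)) = (α + β * p ^ i) * u i` with `u 0 = 1`. -/
noncomputable def ratioSeq (p α β : QAD) (i : ℕ) : QAD :=
  ∏ k ∈ Finset.range i, (α + β * p ^ k) * (1 - p ^ (k + 1))⁻¹

theorem ratioSeq_zero (p α β : QAD) : ratioSeq p α β 0 = 1 := Finset.prod_range_zero _

theorem ratioSeq_succ {p : QAD} (hp : q ∣ p) (α β : QAD) (i : ℕ) :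
    ratioSeq p α β (i + 1) * (1 - p ^ (i + 1)) = (α + β * p ^ i) * ratioSeq p α β i := by
  rw [ratioSeq, Finset.prod_range_succ, ← ratioSeq]
  linear_combination (ratioSeq p α β i * (α + β * p ^ i)) *
    inv_one_sub_mul (z := p ^ (i + 1)) (dvd_pow hp i.succ_ne_zero)

/-- This splits (-x;p)_i off v_i, the factor that cancels in the double sum. -/
theorem ratioSeq_eq_prod_mul {p : QAD} (y x : QAD) (i : ℕ) :
    ratioSeq p y (x * y) i =
      (∏ k ∈ Finset.range i, (1 + x * p ^ k)) * ratioSeq p y 0 i := by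
  rw [ratioSeq, ratioSeq, ← Finset.prod_mul_distrib]
  refine Finset.prod_congr rfl fun k _ => ?_
  ring

/-- The inverses of the finite products `(z; w)_m`. -/
noncomputable def pochInv (z w : QAD) (m : ℕ) : QAD :=
  ∏ k ∈ Finset.range m, (1 - z * w ^ k)⁻¹

theorem pochInv_zero (z w : QAD) : pochInv z w 0 = 1 := Finset.prod_range_zero _

theorem pochInv_succ {z : QAD} (hz : q ∣ z) (w : QAD) (m : ℕ) :
    pochInv z w (m + 1) * (1 - z * w ^ m) = pochInv z w m := by
  rw [pochInv, Finset.prod_range_succ, ← pochInv, mul_assoc,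
    inv_one_sub_mul (dvd_mul_of_dvd_left hz _), mul_one]

theorem pochInv_mul_prod {z : QAD} (hz : q ∣ z) (w : QAD) (m : ℕ) :
    pochInv z w m * ∏ k ∈ Finset.range m, (1 - z * w ^ k) = 1 := by
  rw [pochInv, ← Finset.prod_mul_distrib]
  exact Finset.prod_eq_one fun k _ => inv_one_sub_mul (dvd_mul_of_dvd_left hz _)

theorem dvd_pochInv_mul_qPoch_sub_one {z w : QAD} (hz : q ∣ z) (hw : q ∣ w) (m : ℕ) :
    q ^ m ∣ pochInv z w m * qPoch z w - 1 := by
  refine dvd_sub_of_tendsto ((tendsto_qPoch hw).const_mul (pochInv z w m)) ?_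
  filter_upwards [eventually_ge_atTop m] with k hk
  induction k, hk using Nat.le_induction with
  | base => simp [pochInv_mul_prod hz w m]
  | succ k hk ih =>
    rw [Finset.prod_range_succ]
    have h2 : q ^ m ∣ z * w ^ k := dvd_mul_of_dvd_right (pow_dvd_pow_of_le hw hk) _
    have := dvd_sub ih (dvd_mul_of_dvd_right h2
      (pochInv z w m * ∏ k ∈ Finset.range k, (1 - z * w ^ k)))
    convert this using 1
    ring

variable {Q x y : QAD}

/-- The series `∑ Q ^ (i ^ 2 - i + 2 i j) u i f (i + j)`. -/
noncomputable def shiftedSum (Q : QAD) (u f : ℕ → QAD) (j : ℕ) : QAD :=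
  ∑' i : ℕ, Q ^ (i * (i - 1)) * (Q ^ 2) ^ (i * j) * u i * f (i + j)

theorem le_mul_pred {N i : ℕ} (h : N + 1 ≤ i) : N ≤ i * (i - 1) := by
  obtain ⟨k, rfl⟩ := Nat.exists_eq_add_of_le h
  have : N + 1 + k - 1 = N + k := by omega
  rw [this]
  nlinarith

theorem summable_shiftedSum (hQ : q ∣ Q) (u f : ℕ → QAD) (j : ℕ) :
    Summable fun i : ℕ => Q ^ (i * (i - 1)) * (Q ^ 2) ^ (i * j) * u i * f (i + j) := by
  refine summable_of_dvd fun N => (Set.finite_lt_nat (N + 1)).subset fun i hi => ?_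
  by_contra h
  have h' : N + 1 ≤ i := not_lt.mp h
  exact hi (dvd_mul_of_dvd_left (dvd_mul_of_dvd_left (dvd_mul_of_dvd_left
    (pow_dvd_pow_of_le hQ (le_mul_pred h')) _) _) _)

/-- The difference of the two sides is a telescoping series whose boundary terms vanish. -/
theorem shiftedSum_eq (hQ : q ∣ Q) {B : QAD} {u f : ℕ → QAD}
    (hu : ∀ i, u (i + 1) * (1 - (Q ^ 2) ^ (i + 1)) = (x + B * (Q ^ 2) ^ i) * u i)
    (hf : ∀ i, f (i + 1) * (1 - B * (Q ^ 2) ^ i) = f i) (j : ℕ) :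
    shiftedSum Q u f j = (1 + x * (Q ^ 2) ^ j) * shiftedSum Q u f (j + 1) := by
  set t : ℕ → ℕ → QAD := fun j i => Q ^ (i * (i - 1)) * (Q ^ 2) ^ (i * j) * u i * f (i + j) with ht
  have hs : ∀ j, HasSum (t j) (shiftedSum Q u f j) := fun j => (summable_shiftedSum hQ u f j).hasSum
  -- The telescoping certificate: r 0 = 0 because of the factor 1 - (Q²)^i, and r i tends to 0
  -- because of Q^{i(i-1)}.
  set r : ℕ → QAD := fun i =>
    Q ^ (i * (i - 1)) * (Q ^ 2) ^ (i * j) * u i * f (i + j) * (1 - (Q ^ 2) ^ i) with hr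
  have hstep : ∀ i, t j i - (1 + x * (Q ^ 2) ^ j) * t (j + 1) i = r i - r (i + 1) := by
    intro i
    have e1 : Q ^ ((i + 1) * (i + 1 - 1)) = Q ^ (i * (i - 1)) * Q ^ (2 * i) := by
      rw [← pow_add]
      congr 1
      cases i with
      | zero => rfl
      | succ i => simp only [Nat.add_sub_cancel]; ring
    simp only [ht, hr, e1]
    generalize Q ^ (i * (i - 1)) = T
    have h1 := hu i
    have h2 := hf (i + j)
    rw [show i + 1 + j = i + j + 1 by ring, show i + (j + 1) = i + j + 1 by ring]
    generalize f (i + j + 1) = f1 at *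
    generalize f (i + j) = f0 at *
    linear_combination (T * Q ^ (2 * i) * (Q ^ 2) ^ ((i + 1) * j) * f1) * h1 -
      (T * (Q ^ 2) ^ (i * j) * u i * (Q ^ 2) ^ i) * h2
  have hsum : HasSum (fun i => r i - r (i + 1))
      (shiftedSum Q u f j - (1 + x * (Q ^ 2) ^ j) * shiftedSum Q u f (j + 1)) := by
    simp_rw [← hstep]
    exact (hs j).sub ((hs (j + 1)).mul_left _)
  have h0 : Tendsto (fun n => ∑ i ∈ Finset.range n, (r i - r (i + 1))) atTop (𝓝 0) := by
    refine tendsto_of_dvd fun N => ⟨N + 1, fun n hn => ?_⟩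
    rw [Finset.sum_range_sub', sub_zero]
    have : r 0 = 0 := by simp [hr]
    rw [this, zero_sub, dvd_neg]
    exact dvd_mul_of_dvd_left (dvd_mul_of_dvd_left (dvd_mul_of_dvd_left (dvd_mul_of_dvd_left
      (pow_dvd_pow_of_le hQ (le_mul_pred hn)) _) _) _) _
  exact sub_eq_zero.mp (tendsto_nhds_unique hsum.tendsto_sum_nat h0)

theorem shiftedSum_zero_eq (hQ : q ∣ Q) {B : QAD} {u f : ℕ → QAD}
    (hu : ∀ i, u (i + 1) * (1 - (Q ^ 2) ^ (i + 1)) = (x + B * (Q ^ 2) ^ i) * u i)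
    (hf : ∀ i, f (i + 1) * (1 - B * (Q ^ 2) ^ i) = f i) (j : ℕ) :
    shiftedSum Q u f 0 =
      (∏ k ∈ Finset.range j, (1 + x * (Q ^ 2) ^ k)) * shiftedSum Q u f j := by
  induction j with
  | zero => simp
  | succ j ih => rw [ih, shiftedSum_eq hQ hu hf, Finset.prod_range_succ, mul_assoc]

theorem dvd_shiftedSum_sub (hQ : q ∣ Q) {u f : ℕ → QAD} (hu0 : u 0 = 1) (j : ℕ) :
    q ^ j ∣ shiftedSum Q u f j - f j := by
  refine dvd_sub_of_tendsto (summable_shiftedSum hQ u f j).hasSum.tendsto_sum_nat ?_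
  filter_upwards [eventually_ge_atTop 1] with n hn
  obtain ⟨n, rfl⟩ := Nat.exists_eq_add_of_le' hn
  rw [Finset.sum_range_succ']
  simp only [zero_mul, pow_zero, one_mul, hu0, zero_add, add_sub_cancel_right]
  refine Finset.dvd_sum fun i _ => dvd_mul_of_dvd_left (dvd_mul_of_dvd_left (dvd_mul_of_dvd_right
    (pow_dvd_pow_of_le (dvd_pow hQ two_ne_zero) ?_) _) _) _
  exact Nat.le_mul_of_pos_left j i.succ_pos

/-- The ₁φ₁ summation: iterating the shift produces (-x;Q²)_j, while the shifted sum tends to its i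
= 0 term 1/(B;Q²)_∞. It is used with B = Q and, as Euler's expansion, with B = 0. -/
theorem qPoch_mul_shiftedSum (hQ : q ∣ Q) {B : QAD} (hB : q ∣ B) {u : ℕ → QAD} (hu0 : u 0 = 1)
    (hu : ∀ i, u (i + 1) * (1 - (Q ^ 2) ^ (i + 1)) = (x + B * (Q ^ 2) ^ i) * u i) :
    qPoch B (Q ^ 2) * shiftedSum Q u (pochInv B (Q ^ 2)) 0 = qPoch (-x) (Q ^ 2) := by
  have hp : q ∣ Q ^ 2 := dvd_pow hQ two_ne_zero
  have h1 : Tendsto (fun j => qPoch B (Q ^ 2) * shiftedSum Q u (pochInv B (Q ^ 2)) j) atTop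
      (𝓝 1) := by
    refine tendsto_of_dvd fun N => ⟨N, fun k hk => ?_⟩
    have h := dvd_add (dvd_mul_of_dvd_right
      (dvd_shiftedSum_sub hQ (f := pochInv B (Q ^ 2)) hu0 k) (qPoch B (Q ^ 2)))
      (dvd_pochInv_mul_qPoch_sub_one hB hp k)
    refine (pow_dvd_pow q hk).trans ?_
    convert h using 1
    ring
  have h2 := (tendsto_qPoch (z := -x) hp).mul h1
  rw [mul_one] at h2
  refine tendsto_nhds_unique (tendsto_const_nhds.congr fun j => ?_) h2
  rw [shiftedSum_zero_eq hQ hu (fun i => pochInv_succ hB _ i) j]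
  simp only [neg_mul, sub_neg_eq_add]
  ring

end QAD

/-! ### Evaluation of the double sum and Euler's identity -/

namespace QAD

open Filter
open scoped Topology MvPowerSeries.WithPiTopology

variable {Q x y : QAD}

theorem hasSum_sum_antidiagonal {t : ℕ × ℕ → QAD} (ht : Summable t) :
    HasSum (fun n => ∑ p ∈ Finset.HasAntidiagonal.antidiagonal n, t p) (∑' p, t p) := by
  have := t3Space
  rw [← Finset.HasAntidiagonal.sigmaAntidiagonalEquivProd.tsum_eq t]
  have hs := (Finset.HasAntidiagonal.sigmaAntidiagonalEquivProd.summable_iff (f := t)).mpr ht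
  refine hs.hasSum.sigma fun n => ?_
  rw [← Finset.sum_finset_coe]
  exact hasSum_fintype _

theorem pow_add_pred (i j : ℕ) : Q ^ ((i + j) * (i + j - 1)) =
    Q ^ (j * (j - 1)) * (Q ^ (i * (i - 1)) * (Q ^ 2) ^ (i * j)) := by
  rw [← pow_mul, ← pow_add, ← pow_add]
  congr 1
  rcases i with _ | i
  · simp
  · rcases j with _ | j
    · simp
    · rw [show i + 1 + (j + 1) - 1 = i + j + 1 by omega]
      simp only [Nat.add_sub_cancel]
      ring

theorem qPoch_zero_left (w : QAD) : qPoch 0 w = 1 := by simp [qPoch]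

/-- The terms of the double series whose sum over the antidiagonals is `convTerm`. -/
noncomputable def doubleTerm (Q : QAD) (u v f : ℕ → QAD) (p : ℕ × ℕ) : QAD :=
  Q ^ ((p.2 + p.1) * (p.2 + p.1 - 1)) * (u p.2 * v p.1) * f (p.2 + p.1)

theorem summable_doubleTerm (hQ : q ∣ Q) (u v f : ℕ → QAD) : Summable (doubleTerm Q u v f) := by
  refine summable_of_dvd fun N => ?_
  refine ((Set.finite_lt_nat (N + 1)).prod (Set.finite_lt_nat (N + 1))).subset fun p hp => ?_
  have : p.2 + p.1 < N + 1 := by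
    by_contra h
    exact hp (dvd_mul_of_dvd_left (dvd_mul_of_dvd_left
      (pow_dvd_pow_of_le hQ (le_mul_pred (not_lt.mp h))) _) _)
  simp only [Set.mem_prod, Set.mem_ofPred_eq]
  omega

theorem sum_antidiagonal_doubleTerm (Q : QAD) (u v f : ℕ → QAD) (n : ℕ) :
    ∑ p ∈ Finset.HasAntidiagonal.antidiagonal n, doubleTerm Q u v f p = convTerm Q u v f n := by
  rw [convTerm, mul_comm (PowerSeries.mk u), PowerSeries.coeff_mul, Finset.mul_sum, Finset.sum_mul]
  refine Finset.sum_congr rfl fun p hp => ?_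
  rw [Finset.HasAntidiagonal.mem_antidiagonal, add_comm] at hp
  rw [doubleTerm, hp, PowerSeries.coeff_mk, PowerSeries.coeff_mk]
  ring

theorem exists_hasSum_convTerm (hQ : q ∣ Q) (x y : QAD) :
    ∃ S, HasSum (convTerm Q (ratioSeq (Q ^ 2) x Q) (ratioSeq (Q ^ 2) y (x * y))
      (pochInv Q (Q ^ 2))) S ∧
      qPoch Q (Q ^ 2) * S = qPoch (-x) (Q ^ 2) * qPoch (-y) (Q ^ 2) := by
  have hp : q ∣ Q ^ 2 := dvd_pow hQ two_ne_zero
  set u := ratioSeq (Q ^ 2) x Q with hu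
  set v := ratioSeq (Q ^ 2) y (x * y) with hv
  set f := pochInv Q (Q ^ 2) with hf
  have h := hasSum_sum_antidiagonal (summable_doubleTerm hQ u v f)
  simp only [sum_antidiagonal_doubleTerm] at h
  refine ⟨_, h, ?_⟩
  have hsplit : ∀ j i, doubleTerm Q u v f (j, i) =
      Q ^ (j * (j - 1)) * v j * (Q ^ (i * (i - 1)) * (Q ^ 2) ^ (i * j) * u i * f (i + j)) := by
    intro j i
    rw [doubleTerm, pow_add_pred]
    ring
  -- The factor (-x;Q²)_j in v_j turns the j-th inner sum into the one for j = 0, so the double sum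
  -- factors.
  have hsum : ∑' p, doubleTerm Q u v f p =
      shiftedSum Q u f 0 * shiftedSum Q (ratioSeq (Q ^ 2) y 0) (pochInv 0 (Q ^ 2)) 0 := by
    have := t3Space
    rw [(summable_doubleTerm hQ u v f).tsum_prod' fun j => by
      simp only [hsplit]
      exact (summable_shiftedSum hQ u f j).mul_left _]
    rw [shiftedSum.eq_def Q (ratioSeq (Q ^ 2) y 0),
      ← (summable_shiftedSum hQ (ratioSeq (Q ^ 2) y 0) (pochInv 0 (Q ^ 2)) 0).tsum_mul_left]
    refine tsum_congr fun j => ?_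
    simp only [hsplit]
    rw [(summable_shiftedSum hQ u f j).tsum_mul_left, ← shiftedSum,
      shiftedSum_zero_eq hQ (ratioSeq_succ hp x Q) (fun i => pochInv_succ hQ (Q ^ 2) i) j, hv,
      ratioSeq_eq_prod_mul]
    have : pochInv 0 (Q ^ 2) (j + 0) = 1 := by simp [pochInv]
    rw [this]
    ring
  have h1 := qPoch_mul_shiftedSum (x := x) hQ hQ (ratioSeq_zero _ _ _) (ratioSeq_succ hp x Q)
  have h2 := qPoch_mul_shiftedSum (x := y) hQ (dvd_zero q) (ratioSeq_zero _ _ _)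
    (ratioSeq_succ hp y 0)
  rw [qPoch_zero_left, one_mul] at h2
  rw [hsum, ← mul_assoc, h1, h2]

theorem tendsto_qPoch_mul_boundedSeries (hQ : q ∣ Q) {A : ℕ → QAD} {S : QAD} (hA : HasSum A S)
    (hd : ∀ n, Q ^ (n - 1) ∣ A n) :
    Tendsto (fun m => qPoch Q Q * boundedSeries (pochInv Q Q) A m) atTop (𝓝 S) := by
  set b : ℕ → QAD := fun j => if 2 ∣ j then A (j / 2) else 0 with hb
  have hbS : HasSum b S := by
    have hinj : Function.Injective fun n : ℕ => 2 * n := fun m n h => by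
      have : 2 * m = 2 * n := h
      omega
    rw [← hinj.hasSum_iff]
    · convert hA using 1
      funext n
      simp [hb]
    · intro j hj
      simp only [hb]
      rw [if_neg]
      rintro ⟨n, rfl⟩
      exact hj ⟨n, rfl⟩
  have hbd : ∀ N j, 2 * N + 2 ≤ j → q ^ N ∣ b j := by
    intro N j hj
    simp only [hb]
    split_ifs with h
    · exact (pow_dvd_pow_of_le hQ (by omega)).trans (hd _)
    · exact dvd_zero _
  have hsub : Tendsto (fun m => qPoch Q Q * boundedSeries (pochInv Q Q) A m -
      ∑ j ∈ Finset.range (m + 1), b j) atTop (𝓝 0) := by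
    -- For m ≥ 3N + 2, either j ≥ 2N + 2 and b j is divisible by q^N, or m - j ≥ N and the truncated
    -- product is accurate modulo q^N.
    refine tendsto_of_dvd fun N => ⟨3 * N + 2, fun m hm => ?_⟩
    rw [sub_zero, boundedSeries, mul_comm (PowerSeries.mk _), PowerSeries.coeff_mul,
      Finset.Nat.sum_antidiagonal_eq_sum_range_succ_mk, Finset.mul_sum, ← Finset.sum_sub_distrib]
    refine Finset.dvd_sum fun j hj => ?_
    rw [PowerSeries.coeff_expand, PowerSeries.coeff_mk, PowerSeries.coeff_mk]
    change q ^ N ∣ qPoch Q Q * (b j * pochInv Q Q (m - j)) - b j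
    have e : qPoch Q Q * (b j * pochInv Q Q (m - j)) - b j =
      b j * (pochInv Q Q (m - j) * qPoch Q Q - 1) := by ring
    rw [e]
    rcases le_total (2 * N + 2) j with h | h
    · exact dvd_mul_of_dvd_left (hbd N j h) _
    · exact dvd_mul_of_dvd_right ((pow_dvd_pow q (by omega)).trans
        (dvd_pochInv_mul_qPoch_sub_one hQ hQ (m - j))) _
  have := hsub.add (hbS.tendsto_sum_nat.comp (tendsto_add_atTop_nat 1))
  rw [zero_add] at this
  refine this.congr fun m => ?_
  simp

/-- In (Q;Q)_{2m} the odd powers give (Q;Q²)_m and the even ones split as (1 - Q^k)(1 + Q^k). Let m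
grow and cancel (Q;Q)_∞. -/
theorem qPoch_mul_qPoch_neg (hQ : q ∣ Q) : qPoch Q (Q ^ 2) * qPoch (-Q) Q = 1 := by
  have hp : q ∣ Q ^ 2 := dvd_pow hQ two_ne_zero
  have hne : qPoch Q Q ≠ 0 := by
    intro h
    have := dvd_pochInv_mul_qPoch_sub_one hQ hQ 1
    rw [h, mul_zero, zero_sub, dvd_neg, pow_one] at this
    have := constantCoeff_eq_zero this
    simp at this
  have hprod : ∀ m, ∏ k ∈ Finset.range (2 * m), (1 - Q * Q ^ k) =
      (∏ k ∈ Finset.range m, (1 - Q * Q ^ k)) * ((∏ k ∈ Finset.range m, (1 - Q * (Q ^ 2) ^ k)) *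
        ∏ k ∈ Finset.range m, (1 - -Q * Q ^ k)) := by
    intro m
    induction m with
    | zero => simp
    | succ m ih =>
      rw [show 2 * (m + 1) = 2 * m + 1 + 1 by ring]
      simp only [Finset.prod_range_succ, ih]
      ring
  have hl := (tendsto_qPoch (z := Q) hQ).comp (tendsto_id.const_mul_atTop' two_pos)
  have hr := (tendsto_qPoch (z := Q) hQ).mul
    ((tendsto_qPoch (z := Q) hp).mul (tendsto_qPoch (z := -Q) hQ))
  have := tendsto_nhds_unique hl (hr.congr fun m => (hprod m).symm)
  apply mul_left_cancel₀ hne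
  rw [mul_one]
  exact this.symm

end QAD

/-! ### Closed form for A and passage to the limit -/

namespace P3Partition

open WordCount QAD Filter
open scoped Topology MvPowerSeries.WithPiTopology

theorem tendsto_below (P : ℕ → Prop) (R : ℕ → ℕ → Prop) :
    Tendsto (fun k => below (fun t => (P3Part.nth t).stat) P R (4 * k)) atTop
      (𝓝 (genFun (fun t => (P3Part.nth t).stat) (chains P R))) := by
  rw [MvPowerSeries.WithPiTopology.tendsto_iff_coeff_tendsto]
  intro e
  refine tendsto_const_nhds.congr' ?_
  filter_upwards [eventually_ge_atTop (e 0)] with k hk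
  exact (coeff_below P3Part.lt_four_mul_stat_nth (by omega)).symm

theorem q_dvd_q_cube : q ∣ q ^ 3 := dvd_pow_self q (by norm_num)

theorem q_cube_ne_zero : q ^ 3 ≠ 0 := by
  have hq : q ≠ 0 := fun h => by
    have := congrArg (MvPowerSeries.coeff (Finsupp.single 0 1)) h
    simp [q] at this
  exact pow_ne_zero 3 hq

theorem one_sub_q_cube_pow_ne_zero (k : ℕ) : 1 - (q ^ 3) ^ (k + 1) ≠ 0 :=
  one_sub_ne_zero (dvd_pow q_dvd_q_cube k.succ_ne_zero)

/-- The terms of the closed form of the generating functions for bounded largest part. -/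
noncomputable def closedTerm : ℕ → QAD :=
  convTerm (q ^ 3) (ratioSeq ((q ^ 3) ^ 2) (a * q ^ 2) (q ^ 3))
    (ratioSeq ((q ^ 3) ^ 2) (d * q ^ 4) (a * q ^ 2 * (d * q ^ 4))) (pochInv (q ^ 3) ((q ^ 3) ^ 2))

theorem closedTerm_zero : closedTerm 0 = 1 := by
  simp [closedTerm, convTerm, PowerSeries.coeff_mul, ratioSeq_zero, pochInv_zero]

theorem belowA_eq_boundedSeries (k : ℕ) : belowA (4 * k) =
    boundedSeries (pochInv (q ^ 3) (q ^ 3)) closedTerm (k + 1) * (1 - (q ^ 3) ^ (k + 1)) := by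
  have : IsDomain QAD := NoZeroDivisors.to_isDomain QAD
  have hp : q ∣ (q ^ 3) ^ 2 := dvd_pow q_dvd_q_cube two_ne_zero
  obtain ⟨hA, hA1⟩ := convTerm_recurrence (ratioSeq_succ hp (a * q ^ 2) (q ^ 3))
    (ratioSeq_succ hp (d * q ^ 4) (a * q ^ 2 * (d * q ^ 4)))
    (fun i => pochInv_succ q_dvd_q_cube ((q ^ 3) ^ 2) i)
  obtain ⟨hF, hF2⟩ := boundedSeries_recurrence (e := pochInv (q ^ 3) (q ^ 3))
    (A := closedTerm) q_cube_ne_zero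
    (fun i => by rw [pow_succ' (q ^ 3)]; exact pochInv_succ q_dvd_q_cube (q ^ 3) i) hA hA1
  -- The value 1 at 0 extends ga k = x Q^k h k to the lowest level, where nothing can follow the
  -- part 2.
  let h : ℕ → QAD := fun m => Nat.casesOn m 1 fun k => belowA (4 * k) * (1 - (q ^ 3) ^ (k + 1))⁻¹
  have hG : ∀ k, h (k + 1) * (1 - (q ^ 3) ^ (k + 1)) = belowA (4 * k) := fun k => by
    change belowA (4 * k) * (1 - (q ^ 3) ^ (k + 1))⁻¹ * (1 - (q ^ 3) ^ (k + 1)) = belowA (4 * k)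
    rw [mul_assoc, inv_one_sub_mul (dvd_pow q_dvd_q_cube k.succ_ne_zero), mul_one]
  obtain ⟨hh, hh2⟩ := levelSystem.recurrence one_sub_q_cube_pow_ne_zero (h := h) rfl hG
  have e0 : h 0 = boundedSeries (pochInv (q ^ 3) (q ^ 3)) closedTerm 0 := by
    rw [boundedSeries_zero, closedTerm_zero, pochInv_zero, mul_one]
    rfl
  have e1 : h 1 = boundedSeries (pochInv (q ^ 3) (q ^ 3)) closedTerm 1 := by
    rw [boundedSeries_one, closedTerm_zero, mul_one]
    apply mul_right_cancel₀ (one_sub_q_cube_pow_ne_zero 0)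
    have := pochInv_succ q_dvd_q_cube (q ^ 3) 0
    rw [pow_zero, mul_one, pochInv_zero] at this
    rw [show h 1 = h (0 + 1) from rfl, hG, zero_add, pow_one, this]
    simp [belowA_eq]
  rw [← LevelSystem.eq_of_recurrence one_sub_q_cube_pow_ne_zero hF hF2 hh hh2 e0 e1, hG]

theorem qPoch_mul_genFun_relA :
    qPoch (q ^ 3) (q ^ 3) * genFun (fun t => (P3Part.nth t).stat)
        (chains (fun _ => True) RelA) =
      qPoch (-(a * q ^ 2)) (q ^ 6) * qPoch (-(d * q ^ 4)) (q ^ 6) * qPoch (-q ^ 3) (q ^ 3) := by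
  obtain ⟨S, hS, hprod⟩ := exists_hasSum_convTerm q_dvd_q_cube (a * q ^ 2) (d * q ^ 4)
  have hlim := tendsto_qPoch_mul_boundedSeries q_dvd_q_cube hS fun n => by
    refine dvd_mul_of_dvd_left (dvd_mul_of_dvd_left (pow_dvd_pow _ ?_) _) _
    rcases n with _ | n
    · simp
    · exact Nat.le_mul_of_pos_left _ n.succ_pos
  -- The normalising factor between G_k and h_{k+1} disappears in the limit.
  have hpow : Tendsto (fun k : ℕ => 1 - (q ^ 3) ^ (k + 1)) atTop (𝓝 (1 : QAD)) := by
    refine tendsto_of_dvd fun N => ⟨N, fun k hk => ?_⟩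
    rw [sub_sub_cancel_left, dvd_neg]
    exact pow_dvd_pow_of_le q_dvd_q_cube (hk.trans k.le_succ)
  have h1 := (hlim.comp (tendsto_add_atTop_nat 1)).mul hpow
  rw [mul_one] at h1
  have h2 := (tendsto_below (fun _ => True) RelA).const_mul (qPoch (q ^ 3) (q ^ 3))
  have h3 := tendsto_nhds_unique h2 (h1.congr fun k => by
    change qPoch (q ^ 3) (q ^ 3) * boundedSeries (pochInv (q ^ 3) (q ^ 3)) closedTerm (k + 1) *
      (1 - (q ^ 3) ^ (k + 1)) = qPoch (q ^ 3) (q ^ 3) * belowA (4 * k)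
    rw [belowA_eq_boundedSeries, mul_assoc])
  have h4 := qPoch_mul_qPoch_neg q_dvd_q_cube
  rw [← pow_mul] at hprod h4
  rw [h3, ← hprod, mul_right_comm, h4, one_mul]

theorem qPoch_mul_genFun_relB :
    qPoch (q ^ 3) (q ^ 3) * genFun (fun t => (P3Part.nth t).stat) (chains LetterB RelB) =
      qPoch (-(a * q ^ 2)) (q ^ 6) * qPoch (-(d * q ^ 4)) (q ^ 6) * qPoch (-q ^ 3) (q ^ 3) := by
  have h6 : q ∣ q ^ 6 := dvd_pow_self q (by norm_num)
  have htwo : Tendsto (fun m : ℕ => 2 * m) atTop atTop := tendsto_id.const_mul_atTop' two_pos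
  have hl := ((tendsto_qPoch (z := q ^ 3) q_dvd_q_cube).comp htwo).mul
    ((tendsto_below LetterB RelB).comp htwo)
  have hr := ((tendsto_qPoch (z := -(a * q ^ 2)) h6).mul
    (tendsto_qPoch (z := -(d * q ^ 4)) h6)).mul
    ((tendsto_qPoch (z := -q ^ 3) q_dvd_q_cube).comp htwo)
  exact tendsto_nhds_unique hl (hr.congr fun m => (belowB_eq_prod m).symm)

end P3Partition

theorem mainTheorem4 :
    A3GenFun =
      QAD.qPoch (-(QAD.a * QAD.q ^ 2)) (QAD.q ^ 6) *
        QAD.qPoch (-(QAD.d * QAD.q ^ 4)) (QAD.q ^ 6) *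
        QAD.qPoch (-QAD.q ^ 3) (QAD.q ^ 3) *
        (QAD.qPoch (QAD.q ^ 3) (QAD.q ^ 3))⁻¹ ∧
    ∀ n k m : ℕ, A3 n k m = B3 n k m := by
  have hA := P3Partition.qPoch_mul_genFun_relA
  have hB := P3Partition.qPoch_mul_genFun_relB
  have hc : MvPowerSeries.constantCoeff (QAD.qPoch (QAD.q ^ 3) (QAD.q ^ 3)) ≠ 0 := by
    intro h
    have h1 := QAD.constantCoeff_eq_zero ((pow_one QAD.q).symm.dvd.trans
      (QAD.dvd_pochInv_mul_qPoch_sub_one P3Partition.q_dvd_q_cube P3Partition.q_dvd_q_cube 1))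
    simp [h] at h1
  constructor
  · rw [MvPowerSeries.eq_mul_inv_iff_mul_eq hc, ← hA, mul_comm]
    congr 1
    ext e
    exact P3Partition.A3_eq e
  · intro n k m
    have h0 : QAD.qPoch (QAD.q ^ 3) (QAD.q ^ 3) ≠ 0 := fun h => hc (by rw [h, map_zero])
    have h := mul_left_cancel₀ h0 (hA.trans hB.symm)
    let e : Fin 3 →₀ ℕ := Finsupp.single 0 n + Finsupp.single 1 k + Finsupp.single 2 m
    have e0 : e 0 = n := by simp [e]
    have e1 : e 1 = k := by simp [e]
    have e2 : e 2 = m := by simp [e]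
    have hab : (A3 (e 0) (e 1) (e 2) : ℚ) = B3 (e 0) (e 1) (e 2) := by
      rw [P3Partition.A3_eq, P3Partition.B3_eq, h]
    rw [e0, e1, e2] at hab
    exact_mod_cast hab
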